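/- A feedforward neural network (FNN) in $\mathbf K(1,1)$ is a finite directed acyclic graph with exactly one source (the input node) and exactly one sink (the output node), these two being distinct, with a real bias on every node except the input and a real weight on every edge. It represents the function $f^{\mathcal N}:\mathbb R\to\mathbb R$ obtained by evaluating a hidden node $u$ as $\max(0,\,b(u)+\sum_{v:(v,u)\in E}w(v,u)f_v)$, the output node in the same way without the maximum, and the input node as the identity. A Boolean query $Q$ on $\mathbf K(1,1)$ is model-agnostic if $f^{\mathcal N}=f^{\mathcal N'}$ implies $Q(\mathcal N)\Leftrightarrow Q(\mathcal N')$. A network is regarded as a finite weighted structure $(V,E,\mathrm{In},\mathrm{Out},b,w)$ on its set $V$ of nodes, where $\mathrm{In}$ and $\mathrm{Out}$ are the linear orders on the input nodes and on the output nodes, and $b$ and $w$ take values in $\mathbb R\cup\{\bot\}$, with $b=\bot$ on the input node and $w=\bot$ on non-edges. The logic IFP(SUM) over weighted structures has formulas built from equalities, relational atoms and comparisons $\theta\le\theta'$ of weight terms ($\bot$ being least) by Boolean connectives and quantifiers over the universe. Its weight terms are built from rational constants, $\bot$ and weight functions by $+,-,\cdot,/$ (with value $\bot$ if an argument is $\bot$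 or on division by $0$), "if $\varphi$ then $\theta$ else $\theta'$", summation $\sum_{\vec x:\varphi}\theta$ over the tuples satisfying $\varphi$, and functional fixpoints $\mathrm{ifp}(F(\vec x)\leftarrow\theta)(\vec x')$, possibly nested. In such a fixpoint $F$ starts as $\bot$ everywhere and is repeatedly updated by the value of $\theta$ at exactly those tuples where $F$ is still $\bot$. **Theorem.** Let $Q$ be the Boolean query on $\mathbf K(1,1)$ that is true on $\mathcal N$ iff $f^{\mathcal N}(1)$ is an even natural number. Then: 1. $Q$ is model-agnostic; 2. $Q$ is decidable in polynomial time: there is an algorithm that decides $Q(\mathcal N)$ for every network $\mathcal N\in\mathbf K(1,1)$ with rational biases and weights, in time polynomial in the bit size of an encoding of $\mathcal N$ (adjacency matrix, with numerators and denominators in binary); 3. $Q$ is not expressible in IFP(SUM), even on networks whose biases and weights are all $0$ or $1$: there is no IFP(SUM) sentence $\varphi$ such that $\mathcal N\models\varphi\Leftrightarrow Q(\mathcal N)$ holds for every $\mathcal N\in\mathbf K(1,1)$ all of whose biases and edge weights lie in $\{0,1\}$. -/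

import Mathlib

/-! ### Feedforward neural networks -/

/-- A feedforward neural network with `m` inputs, `p` outputs and weights in `R`: a finite directed
acyclic graph whose sources are the nodes `inp 0, …, inp (m-1)` and whose sinks are the nodes
`out 0, …, out (p-1)`; every node that is not an input has a bias and every edge has a weight.
The functions `bias` and `weight` are total; where there is no bias or weight they are `0`, by
convention. An edge may have weight `0`. `FNN m p ℝ` is the class `K(m,p)`. -/
structure FNN (m p : ℕ) (R : Type) [Zero R] where
  V : Type
  [fintypeV : Fintype V]
  E : V → V → Prop
  inp : Fin m → V
  out : Fin p → V
  bias : V → R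
  weight : V → V → R
  acyclic : ∀ v, ¬ Relation.TransGen E v v
  inp_injective : Function.Injective inp
  out_injective : Function.Injective out
  inp_ne_out : ∀ i j, inp i ≠ out j
  source_iff : ∀ v, (∀ u, ¬ E u v) ↔ ∃ i, inp i = v
  sink_iff : ∀ v, (∀ u, ¬ E v u) ↔ ∃ j, out j = v
  bias_inp : ∀ i, bias (inp i) = 0
  weight_of_not_edge : ∀ u v, ¬ E u v → weight u v = 0

namespace FNN

attribute [instance] FNN.fintypeV

theorem wellFounded_edge {m p : ℕ} {R : Type} [Zero R] (N : FNN m p R) : WellFounded N.E := by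
  have : Std.Irrefl (Relation.TransGen N.E) := ⟨N.acyclic⟩
  have : IsTrans N.V (Relation.TransGen N.E) := ⟨fun _ _ _ => Relation.TransGen.trans⟩
  exact Subrelation.wf (fun h => Relation.TransGen.single h)
    (Finite.wellFounded_of_trans_of_irrefl (Relation.TransGen N.E))

open Classical in
/-- The function `ℝᵐ → ℝ` computed at a node, by recursion along the edges: inputs return the
corresponding coordinate, outputs are linear, hidden nodes apply `ReLU z = max 0 z`. -/
noncomputable def nodeValue {m p : ℕ} (N : FNN m p ℝ) (x : Fin m → ℝ) : N.V → ℝ :=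
  N.wellFounded_edge.fix fun u rec =>
    if h : ∃ i, N.inp i = u then x h.choose
    else if ∃ j, N.out j = u then
      N.bias u + ∑ v, if hv : N.E v u then N.weight v u * rec v hv else 0
    else max 0 (N.bias u + ∑ v, if hv : N.E v u then N.weight v u * rec v hv else 0)

/-- The function `ℝᵐ → ℝᵖ` represented by a network. -/
noncomputable def toFun {m p : ℕ} (N : FNN m p ℝ) (x : Fin m → ℝ) : Fin p → ℝ :=
  fun j => N.nodeValue x (N.out j)

/-- All weights, on the edges and on the nodes (biases), are `0` or `1`. -/
def ZeroOneWeights {m p : ℕ} (N : FNN m p ℝ) : Prop :=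
  (∀ v, (∀ i, N.inp i ≠ v) → N.bias v = 0 ∨ N.bias v = 1) ∧
    ∀ u v, N.E u v → N.weight u v = 0 ∨ N.weight u v = 1

/-- A network with rational weights, viewed as a network with real weights. -/
def toReal {m p : ℕ} (N : FNN m p ℚ) : FNN m p ℝ where
  V := N.V
  E := N.E
  inp := N.inp
  out := N.out
  bias v := (N.bias v : ℝ)
  weight u v := (N.weight u v : ℝ)
  acyclic := N.acyclic
  inp_injective := N.inp_injective
  out_injective := N.out_injective
  inp_ne_out := N.inp_ne_out
  source_iff := N.source_iff
  sink_iff := N.sink_iff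
  bias_inp i := by simp [N.bias_inp i]
  weight_of_not_edge u v h := by simp [N.weight_of_not_edge u v h]

end FNN

/-! ### Boolean queries -/

/-- A Boolean query (without parameters) on `K(m,p)`. -/
abbrev BoolQuery (m p : ℕ) : Type 1 := FNN m p ℝ → Prop

/-- A query is model-agnostic if it does not distinguish networks representing the same function. -/
def BoolQuery.ModelAgnostic {m p : ℕ} (Q : BoolQuery m p) : Prop :=
  ∀ N N' : FNN m p ℝ, N.toFun = N'.toFun → (Q N ↔ Q N')

/-- The query on `K(1,1)` asking whether `f(1)` is an even natural number. -/
def evenAtOne : BoolQuery 1 1 :=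
  fun N => ∃ k : ℕ, Even k ∧ N.toFun (fun _ => 1) 0 = (k : ℝ)

/-! ### Weighted structures -/

/-- A weighted vocabulary: relation symbols and weight-function symbols with their arities. -/
structure WVocab where
  Rel : Type
  Fn : Type
  relArity : Rel → ℕ
  fnArity : Fn → ℕ

/-- A weighted structure with universe `A`. Weights lie in `ℝ ∪ {⊥}`, where `⊥` is below every
real number. -/
structure WStructure (Υ : WVocab) (A : Type) where
  rel : ∀ R : Υ.Rel, (Fin (Υ.relArity R) → A) → Prop
  fn : ∀ F : Υ.Fn, (Fin (Υ.fnArity F) → A) → WithBot ℝ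

/-- Relation symbols of the vocabulary of networks. -/
inductive NetRel
  | edge
  | input
  | output

/-- Weight-function symbols of the vocabulary of networks. -/
inductive NetFn
  | bias
  | weight

/-- The vocabulary `(E, In, Out, b, w)`: three binary relations, a unary and a binary weight
function. -/
def netVocab : WVocab where
  Rel := NetRel
  Fn := NetFn
  relArity _ := 2
  fnArity
    | .bias => 1
    | .weight => 2

open Classical in
/-- A network as a weighted structure on its set of nodes: `In` and `Out` are the (reflexive) linear
orders of the input nodes and of the output nodes, `b` is undefined on inputs, and `w` is undefined
on pairs that are not edges. -/
noncomputable def FNN.toStructure {m p : ℕ} (N : FNN m p ℝ) : WStructure netVocab N.V where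
  rel
    | .edge => fun a : Fin 2 → N.V => N.E (a 0) (a 1)
    | .input => fun a : Fin 2 → N.V => ∃ i j, i ≤ j ∧ a 0 = N.inp i ∧ a 1 = N.inp j
    | .output => fun a : Fin 2 → N.V => ∃ i j, i ≤ j ∧ a 0 = N.out i ∧ a 1 = N.out j
  fn
    | .bias => fun a : Fin 1 → N.V =>
        if ∃ i, N.inp i = a 0 then ⊥ else (N.bias (a 0) : WithBot ℝ)
    | .weight => fun a : Fin 2 → N.V =>
        if N.E (a 0) (a 1) then (N.weight (a 0) (a 1) : WithBot ℝ) else ⊥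

/-! ### The logic IFP(SUM) -/

/-- `FnVar Γ k`: an occurrence of the arity `k` in the list `Γ`, used as a name for the `k`-ary
intensional weight-function symbol introduced by one of the enclosing `ifp` operators, whose
arities, from the innermost to the outermost, are listed in `Γ`. -/
inductive FnVar : List ℕ → ℕ → Type
  | zero {Γ : List ℕ} {k : ℕ} : FnVar (k :: Γ) k
  | succ {Γ : List ℕ} {k l : ℕ} : FnVar Γ k → FnVar (l :: Γ) k

mutual

/-- Formulas of IFP(SUM) over `Υ`, with element variables `0, …, n-1` and with intensional
weight-function symbols of the arities listed in `Γ`. A binder for `k` variables introduces the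
variables `n, …, n+k-1`. -/
inductive IFPFormula (Υ : WVocab) : List ℕ → ℕ → Type
  | eq {Γ : List ℕ} {n : ℕ} (x y : Fin n) : IFPFormula Υ Γ n
  | rel {Γ : List ℕ} {n : ℕ} (R : Υ.Rel) (x : Fin (Υ.relArity R) → Fin n) : IFPFormula Υ Γ n
  | le {Γ : List ℕ} {n : ℕ} (θ₁ θ₂ : IFPTerm Υ Γ n) : IFPFormula Υ Γ n
  | not {Γ : List ℕ} {n : ℕ} (φ : IFPFormula Υ Γ n) : IFPFormula Υ Γ n
  | or {Γ : List ℕ} {n : ℕ} (φ ψ : IFPFormula Υ Γ n) : IFPFormula Υ Γ n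
  | and {Γ : List ℕ} {n : ℕ} (φ ψ : IFPFormula Υ Γ n) : IFPFormula Υ Γ n
  | imp {Γ : List ℕ} {n : ℕ} (φ ψ : IFPFormula Υ Γ n) : IFPFormula Υ Γ n
  | ex {Γ : List ℕ} {n : ℕ} (φ : IFPFormula Υ Γ (n + 1)) : IFPFormula Υ Γ n
  | all {Γ : List ℕ} {n : ℕ} (φ : IFPFormula Υ Γ (n + 1)) : IFPFormula Υ Γ n

/-- Weight terms of IFP(SUM): rational constants or `⊥`, extensional and intensional weight
functions, arithmetic, `if φ then θ₁ else θ₂`, summation of `θ` over all `k`-tuples satisfying `φ`,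
and the functional fixpoint `ifp (F(y₁,…,y_k) ← θ) (x)`. -/
inductive IFPTerm (Υ : WVocab) : List ℕ → ℕ → Type
  | const {Γ : List ℕ} {n : ℕ} (r : WithBot ℚ) : IFPTerm Υ Γ n
  | fn {Γ : List ℕ} {n : ℕ} (F : Υ.Fn) (x : Fin (Υ.fnArity F) → Fin n) : IFPTerm Υ Γ n
  | ifn {Γ : List ℕ} {n k : ℕ} (F : FnVar Γ k) (x : Fin k → Fin n) : IFPTerm Υ Γ n
  | add {Γ : List ℕ} {n : ℕ} (θ₁ θ₂ : IFPTerm Υ Γ n) : IFPTerm Υ Γ n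
  | sub {Γ : List ℕ} {n : ℕ} (θ₁ θ₂ : IFPTerm Υ Γ n) : IFPTerm Υ Γ n
  | mul {Γ : List ℕ} {n : ℕ} (θ₁ θ₂ : IFPTerm Υ Γ n) : IFPTerm Υ Γ n
  | div {Γ : List ℕ} {n : ℕ} (θ₁ θ₂ : IFPTerm Υ Γ n) : IFPTerm Υ Γ n
  | cond {Γ : List ℕ} {n : ℕ} (φ : IFPFormula Υ Γ n) (θ₁ θ₂ : IFPTerm Υ Γ n) : IFPTerm Υ Γ n
  | sum {Γ : List ℕ} {n : ℕ} (k : ℕ) (φ : IFPFormula Υ Γ (n + k)) (θ : IFPTerm Υ Γ (n + k)) :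
      IFPTerm Υ Γ n
  | ifp {Γ : List ℕ} {n : ℕ} (k : ℕ) (θ : IFPTerm Υ (k :: Γ) (n + k)) (x : Fin k → Fin n) :
      IFPTerm Υ Γ n

end

/-- Arithmetic on `ℝ ∪ {⊥}`: the result is `⊥` as soon as one argument is `⊥`. -/
noncomputable def botLift (op : ℝ → ℝ → WithBot ℝ) : WithBot ℝ → WithBot ℝ → WithBot ℝ
  | (x : ℝ), (y : ℝ) => op x y
  | _, _ => ⊥

/-- Interpretations of the intensional symbols in `Γ` as weight functions on `A`. -/
abbrev FnEnv (Γ : List ℕ) (A : Type) : Type := ∀ k : ℕ, FnVar Γ k → (Fin k → A) → WithBot ℝ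

/-- The interpretation that extends `ρ` by `f` for the new symbol. -/
def FnEnv.cons {Γ : List ℕ} {A : Type} {k : ℕ} (f : (Fin k → A) → WithBot ℝ) (ρ : FnEnv Γ A) :
    FnEnv (k :: Γ) A
  | _, .zero => f
  | l, .succ X => ρ l X

/-- The interpretation of the empty list of intensional symbols. -/
def FnEnv.nil (A : Type) : FnEnv [] A :=
  fun _ X => nomatch X

open Classical in
/-- The stages of the functional fixpoint of an operator `Φ` on weight functions: start with the
function that is undefined everywhere, and update only where the function is still undefined. -/
noncomputable def ifpStage {T : Type} (Φ : (T → WithBot ℝ) → T → WithBot ℝ) :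
    ℕ → T → WithBot ℝ
  | 0 => fun _ => ⊥
  | t + 1 => fun a => if ifpStage Φ t a = ⊥ then Φ (ifpStage Φ t) a else ifpStage Φ t a

open Classical in
/-- The functional fixpoint: the first value different from `⊥` that is taken at some stage, and `⊥`
if there is none. -/
noncomputable def ifpLimit {T : Type} (Φ : (T → WithBot ℝ) → T → WithBot ℝ) (a : T) : WithBot ℝ :=
  if h : ∃ t, ifpStage Φ t a ≠ ⊥ then ifpStage Φ (Nat.find h) a else ⊥

open Classical in
mutual

/-- Truth of a formula in a finite weighted structure. -/
noncomputable def IFPFormula.Holds {Υ : WVocab} {A : Type} [Fintype A] (𝔄 : WStructure Υ A) :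
    {Γ : List ℕ} → {n : ℕ} → IFPFormula Υ Γ n → FnEnv Γ A → (Fin n → A) → Prop
  | _, _, .eq x y, _, ν => ν x = ν y
  | _, _, .rel R x, _, ν => 𝔄.rel R (fun i => ν (x i))
  | _, _, .le θ₁ θ₂, ρ, ν => θ₁.value 𝔄 ρ ν ≤ θ₂.value 𝔄 ρ ν
  | _, _, .not φ, ρ, ν => ¬ φ.Holds 𝔄 ρ ν
  | _, _, .or φ ψ, ρ, ν => φ.Holds 𝔄 ρ ν ∨ ψ.Holds 𝔄 ρ ν
  | _, _, .and φ ψ, ρ, ν => φ.Holds 𝔄 ρ ν ∧ ψ.Holds 𝔄 ρ ν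
  | _, _, .imp φ ψ, ρ, ν => φ.Holds 𝔄 ρ ν → ψ.Holds 𝔄 ρ ν
  | _, _, .ex φ, ρ, ν => ∃ a : A, φ.Holds 𝔄 ρ (Fin.append ν (fun _ : Fin 1 => a))
  | _, _, .all φ, ρ, ν => ∀ a : A, φ.Holds 𝔄 ρ (Fin.append ν (fun _ : Fin 1 => a))

/-- The value of a weight term in a finite weighted structure. Division by `0` yields `⊥`. A sum
ranges over the tuples satisfying the formula; it is `⊥` if one of its summands is, and an empty sum
is `0`. -/
noncomputable def IFPTerm.value {Υ : WVocab} {A : Type} [Fintype A] (𝔄 : WStructure Υ A) :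
    {Γ : List ℕ} → {n : ℕ} → IFPTerm Υ Γ n → FnEnv Γ A → (Fin n → A) → WithBot ℝ
  | _, _, .const r, _, _ => r.map (fun q : ℚ => (q : ℝ))
  | _, _, .fn F x, _, ν => 𝔄.fn F (fun i => ν (x i))
  | _, _, .ifn F x, ρ, ν => ρ _ F (fun i => ν (x i))
  | _, _, .add θ₁ θ₂, ρ, ν =>
      botLift (fun x y => ((x + y : ℝ) : WithBot ℝ)) (θ₁.value 𝔄 ρ ν) (θ₂.value 𝔄 ρ ν)
  | _, _, .sub θ₁ θ₂, ρ, ν =>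
      botLift (fun x y => ((x - y : ℝ) : WithBot ℝ)) (θ₁.value 𝔄 ρ ν) (θ₂.value 𝔄 ρ ν)
  | _, _, .mul θ₁ θ₂, ρ, ν =>
      botLift (fun x y => ((x * y : ℝ) : WithBot ℝ)) (θ₁.value 𝔄 ρ ν) (θ₂.value 𝔄 ρ ν)
  | _, _, .div θ₁ θ₂, ρ, ν =>
      botLift (fun x y => if y = 0 then ⊥ else ((x / y : ℝ) : WithBot ℝ))
        (θ₁.value 𝔄 ρ ν) (θ₂.value 𝔄 ρ ν)
  | _, _, .cond φ θ₁ θ₂, ρ, ν =>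
      if φ.Holds 𝔄 ρ ν then θ₁.value 𝔄 ρ ν else θ₂.value 𝔄 ρ ν
  | _, _, .sum k φ θ, ρ, ν =>
      ∑ a : Fin k → A,
        if φ.Holds 𝔄 ρ (Fin.append ν a) then θ.value 𝔄 ρ (Fin.append ν a) else 0
  | _, _, .ifp k θ x, ρ, ν =>
      ifpLimit (fun (f : (Fin k → A) → WithBot ℝ) (a : Fin k → A) =>
        θ.value 𝔄 (FnEnv.cons f ρ) (Fin.append ν a)) (fun i => ν (x i))

end

/-- Closed formulas of IFP(SUM): no free variables and no unbound intensional symbols. -/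
abbrev IFPSentence (Υ : WVocab) : Type := IFPFormula Υ [] 0

/-- `𝔄 ⊨ φ` for a sentence `φ`. -/
def WStructure.Models {Υ : WVocab} {A : Type} [Fintype A] (𝔄 : WStructure Υ A)
    (φ : IFPSentence Υ) : Prop :=
  φ.Holds 𝔄 (FnEnv.nil A) Fin.elim0

/-- `Q` is expressible in IFP(SUM) on the class `𝒞` of networks: one sentence defines `Q` on all
networks of the class. -/
def BoolQuery.ExpressibleOn {m p : ℕ} (Q : BoolQuery m p) (𝒞 : FNN m p ℝ → Prop) : Prop :=
  ∃ φ : IFPSentence netVocab, ∀ N : FNN m p ℝ, 𝒞 N → (N.toStructure.Models φ ↔ Q N)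

/-! ### Polynomial time: random access machines with logarithmic cost

A program works on integer variables and integer arrays. Every number that is computed, read, or
used as an address is charged its binary length, so running times are polynomially related to those
of Turing machines. -/

/-- Binary length of an integer (with one extra bit). -/
def bitLength (z : ℤ) : ℕ := Nat.size z.natAbs + 1

/-- Memory: integer variables, and arrays indexed by integers. -/
structure RamState where
  var : ℕ → ℤ
  cell : ℕ → ℤ → ℤ

/-- Arithmetic expressions; `cell a e` reads array `a` at index `e`. -/
inductive RamExpr
  | lit (z : ℤ)
  | var (i : ℕ)
  | cell (a : ℕ) (e : RamExpr)
  | add (e₁ e₂ : RamExpr)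
  | sub (e₁ e₂ : RamExpr)
  | mul (e₁ e₂ : RamExpr)
  | div (e₁ e₂ : RamExpr)

/-- The value of an expression; `div` is integer division. -/
def RamExpr.eval (s : RamState) : RamExpr → ℤ
  | .lit z => z
  | .var i => s.var i
  | .cell a e => s.cell a (e.eval s)
  | .add e₁ e₂ => e₁.eval s + e₂.eval s
  | .sub e₁ e₂ => e₁.eval s - e₂.eval s
  | .mul e₁ e₂ => e₁.eval s * e₂.eval s
  | .div e₁ e₂ => e₁.eval s / e₂.eval s

/-- The cost of evaluating an expression: the sum of the binary lengths of the values of all its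
subexpressions. -/
def RamExpr.cost (s : RamState) : RamExpr → ℕ
  | .lit z => bitLength z
  | .var i => bitLength (s.var i)
  | .cell a e => e.cost s + bitLength ((RamExpr.cell a e).eval s)
  | .add e₁ e₂ => e₁.cost s + e₂.cost s + bitLength ((RamExpr.add e₁ e₂).eval s)
  | .sub e₁ e₂ => e₁.cost s + e₂.cost s + bitLength ((RamExpr.sub e₁ e₂).eval s)
  | .mul e₁ e₂ => e₁.cost s + e₂.cost s + bitLength ((RamExpr.mul e₁ e₂).eval s)
  | .div e₁ e₂ => e₁.cost s + e₂.cost s + bitLength ((RamExpr.div e₁ e₂).eval s)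

/-- Programs; `assign i e` sets a variable, `store a e₁ e₂` writes the value of `e₂` to array `a` at
index `e₁`, and the tests of `cond` and `loop` ask whether the value of `e` is positive. -/
inductive RamProg
  | skip
  | assign (i : ℕ) (e : RamExpr)
  | store (a : ℕ) (e₁ e₂ : RamExpr)
  | seq (c₁ c₂ : RamProg)
  | cond (e : RamExpr) (c₁ c₂ : RamProg)
  | loop (e : RamExpr) (c : RamProg)

/-- `RamRuns c s t s'`: started in state `s`, the program `c` halts in state `s'` after a computation
of total cost `t`. -/
inductive RamRuns : RamProg → RamState → ℕ → RamState → Prop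
  | skip (s : RamState) : RamRuns .skip s 1 s
  | assign (i : ℕ) (e : RamExpr) (s : RamState) :
      RamRuns (.assign i e) s (e.cost s + 1) { s with var := Function.update s.var i (e.eval s) }
  | store (a : ℕ) (e₁ e₂ : RamExpr) (s : RamState) :
      RamRuns (.store a e₁ e₂) s (e₁.cost s + e₂.cost s + 1)
        { s with cell := Function.update s.cell a
                   (Function.update (s.cell a) (e₁.eval s) (e₂.eval s)) }
  | seq {c₁ c₂ : RamProg} {s s₁ s₂ : RamState} {t₁ t₂ : ℕ} :
      RamRuns c₁ s t₁ s₁ → RamRuns c₂ s₁ t₂ s₂ → RamRuns (.seq c₁ c₂) s (t₁ + t₂ + 1) s₂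
  | cond_pos {e : RamExpr} {c₁ c₂ : RamProg} {s s' : RamState} {t : ℕ} :
      0 < e.eval s → RamRuns c₁ s t s' → RamRuns (.cond e c₁ c₂) s (e.cost s + t + 1) s'
  | cond_neg {e : RamExpr} {c₁ c₂ : RamProg} {s s' : RamState} {t : ℕ} :
      ¬ 0 < e.eval s → RamRuns c₂ s t s' → RamRuns (.cond e c₁ c₂) s (e.cost s + t + 1) s'
  | loop_step {e : RamExpr} {c : RamProg} {s s₁ s₂ : RamState} {t₁ t₂ : ℕ} :
      0 < e.eval s → RamRuns c s t₁ s₁ → RamRuns (.loop e c) s₁ t₂ s₂ →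
        RamRuns (.loop e c) s (e.cost s + t₁ + t₂ + 1) s₂
  | loop_done {e : RamExpr} {c : RamProg} {s : RamState} :
      ¬ 0 < e.eval s → RamRuns (.loop e c) s (e.cost s + 1) s

/-- The initial state on an input: variable `0` holds the length of the input, array `0` holds the
input, everything else is `0`. -/
def RamState.start (l : List ℤ) : RamState where
  var i := if i = 0 then (l.length : ℤ) else 0
  cell a z := if a = 0 ∧ 0 ≤ z then l.getD z.toNat 0 else 0

/-- The size of an input in bits. -/
def inputSize (l : List ℤ) : ℕ := (l.map bitLength).sum

open Classical in
/-- The encoding of a network with rational weights, one input and one output, with respect to an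
enumeration `e` of its nodes: the number of nodes, the indices of the input and of the output node,
the numerator and the denominator of every bias, and, for every pair of nodes, a bit telling whether
it is an edge, followed by the numerator and the denominator of its weight. -/
noncomputable def FNN.encode (N : FNN 1 1 ℚ) {n : ℕ} (e : Fin n ≃ N.V) : List ℤ :=
  [(n : ℤ), ((e.symm (N.inp 0) : ℕ) : ℤ), ((e.symm (N.out 0) : ℕ) : ℤ)] ++
  ((List.finRange n).flatMap fun i => [(N.bias (e i)).num, ((N.bias (e i)).den : ℤ)]) ++
  ((List.finRange n).flatMap fun i => (List.finRange n).flatMap fun j =>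
    [if N.E (e i) (e j) then 1 else 0,
      (N.weight (e i) (e j)).num, ((N.weight (e i) (e j)).den : ℤ)])

/-- A Boolean query on `K(1,1)` is decidable in polynomial time if some program, given any encoding
of any network with rational weights, halts within a time that is polynomial in the size of the
encoding, with `1` in variable `0` if the query is true on the network, and with `0` in variable `0`
if it is false. -/
def BoolQuery.PolyTimeDecidable (Q : BoolQuery 1 1) : Prop :=
  ∃ (c : RamProg) (P : Polynomial ℕ),
    ∀ (N : FNN 1 1 ℚ) (n : ℕ) (e : Fin n ≃ N.V),
      ∃ (t : ℕ) (s : RamState), RamRuns c (RamState.start (N.encode e)) t s ∧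
        t ≤ P.eval (inputSize (N.encode e)) ∧
        (Q N.toReal → s.var 0 = 1) ∧ (¬ Q N.toReal → s.var 0 = 0)

open Filter Polynomial

section Isomorphism

/-- A permutation of the universe that preserves all relations and weight functions. -/
def WStructure.IsAut {Υ : WVocab} {A : Type} (𝔄 : WStructure Υ A) (π : Equiv.Perm A) : Prop :=
  (∀ R a, 𝔄.rel R (π ∘ a) ↔ 𝔄.rel R a) ∧ ∀ F a, 𝔄.fn F (π ∘ a) = 𝔄.fn F a

theorem comp_append {A B : Type} (f : A → B) {n k : ℕ} (ν : Fin n → A) (a : Fin k → A) :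
    f ∘ Fin.append ν a = Fin.append (f ∘ ν) (f ∘ a) := by
  funext i
  refine Fin.addCases (fun i => ?_) (fun i => ?_) i <;> simp

/-- The environment `ρ'` is the image of `ρ` under `π`. -/
def FnEnv.Transport {A : Type} (π : Equiv.Perm A) {Γ : List ℕ} (ρ ρ' : FnEnv Γ A) : Prop :=
  ∀ k X a, ρ' k X (π ∘ a) = ρ k X a

theorem FnEnv.Transport.cons {A : Type} {π : Equiv.Perm A} {Γ : List ℕ} {ρ ρ' : FnEnv Γ A}
    (h : FnEnv.Transport π ρ ρ') {k : ℕ} {f f' : (Fin k → A) → WithBot ℝ}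
    (hf : ∀ a, f' (π ∘ a) = f a) : FnEnv.Transport π (FnEnv.cons f ρ) (FnEnv.cons f' ρ')
  | _, .zero, a => hf a
  | l, .succ X, a => h l X a

theorem ifpStage_transport {T : Type} (π : Equiv.Perm T)
    (Φ Φ' : (T → WithBot ℝ) → T → WithBot ℝ)
    (h : ∀ f f', (∀ a, f' (π a) = f a) → ∀ a, Φ' f' (π a) = Φ f a) (t : ℕ) (a : T) :
    ifpStage Φ' t (π a) = ifpStage Φ t a := by
  induction t generalizing a with
  | zero => rfl
  | succ t ih => simp only [ifpStage, ih, h _ _ ih]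

theorem ifpLimit_transport {T : Type} (π : Equiv.Perm T)
    (Φ Φ' : (T → WithBot ℝ) → T → WithBot ℝ)
    (h : ∀ f f', (∀ a, f' (π a) = f a) → ∀ a, Φ' f' (π a) = Φ f a) (a : T) :
    ifpLimit Φ' (π a) = ifpLimit Φ a := by
  classical
  have key : ∀ g g' : ℕ → WithBot ℝ, g = g' →
      (if h : ∃ t, g t ≠ ⊥ then g (Nat.find h) else ⊥) =
        if h : ∃ t, g' t ≠ ⊥ then g' (Nat.find h) else ⊥ := by
    rintro g _ rfl
    rfl
  unfold ifpLimit
  convert key _ _ (funext fun t => ifpStage_transport π Φ Φ' h t a)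

variable {Υ : WVocab} {A : Type} [Fintype A] {𝔄 : WStructure Υ A} {π : Equiv.Perm A}

open Classical in
mutual

theorem IFPFormula.holds_transport (hπ : 𝔄.IsAut π) : {Γ : List ℕ} → {n : ℕ} →
    (φ : IFPFormula Υ Γ n) → (ρ ρ' : FnEnv Γ A) → FnEnv.Transport π ρ ρ' → (ν : Fin n → A) →
    (φ.Holds 𝔄 ρ' (π ∘ ν) ↔ φ.Holds 𝔄 ρ ν)
  | _, _, .eq x y, ρ, ρ', h, ν => by simp [IFPFormula.Holds]
  | _, _, .rel R x, ρ, ρ', h, ν => by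
      simp only [IFPFormula.Holds]
      exact hπ.1 R (fun i => ν (x i))
  | _, _, .le θ₁ θ₂, ρ, ρ', h, ν => by
      simp only [IFPFormula.Holds, IFPTerm.value_transport hπ θ₁ ρ ρ' h,
        IFPTerm.value_transport hπ θ₂ ρ ρ' h]
  | _, _, .not φ, ρ, ρ', h, ν => by
      simp only [IFPFormula.Holds, IFPFormula.holds_transport hπ φ ρ ρ' h]
  | _, _, .or φ ψ, ρ, ρ', h, ν => by
      simp only [IFPFormula.Holds, IFPFormula.holds_transport hπ φ ρ ρ' h,
        IFPFormula.holds_transport hπ ψ ρ ρ' h]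
  | _, _, .and φ ψ, ρ, ρ', h, ν => by
      simp only [IFPFormula.Holds, IFPFormula.holds_transport hπ φ ρ ρ' h,
        IFPFormula.holds_transport hπ ψ ρ ρ' h]
  | _, _, .imp φ ψ, ρ, ρ', h, ν => by
      simp only [IFPFormula.Holds, IFPFormula.holds_transport hπ φ ρ ρ' h,
        IFPFormula.holds_transport hπ ψ ρ ρ' h]
  | _, _, .ex φ, ρ, ρ', h, ν => by
      simp only [IFPFormula.Holds]
      refine (π.exists_congr fun a => ?_).symm
      rw [← IFPFormula.holds_transport hπ φ ρ ρ' h, comp_append]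
      rfl
  | _, _, .all φ, ρ, ρ', h, ν => by
      simp only [IFPFormula.Holds]
      refine (π.forall_congr fun a => ?_).symm
      rw [← IFPFormula.holds_transport hπ φ ρ ρ' h, comp_append]
      rfl

theorem IFPTerm.value_transport (hπ : 𝔄.IsAut π) : {Γ : List ℕ} → {n : ℕ} →
    (θ : IFPTerm Υ Γ n) → (ρ ρ' : FnEnv Γ A) → FnEnv.Transport π ρ ρ' → (ν : Fin n → A) →
    θ.value 𝔄 ρ' (π ∘ ν) = θ.value 𝔄 ρ ν
  | _, _, .const r, ρ, ρ', h, ν => by simp only [IFPTerm.value]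
  | _, _, .fn F x, ρ, ρ', h, ν => by
      simp only [IFPTerm.value]
      exact hπ.2 F (fun i => ν (x i))
  | _, _, .ifn F x, ρ, ρ', h, ν => by
      simp only [IFPTerm.value]
      exact h _ F (fun i => ν (x i))
  | _, _, .add θ₁ θ₂, ρ, ρ', h, ν => by
      simp only [IFPTerm.value, IFPTerm.value_transport hπ θ₁ ρ ρ' h,
        IFPTerm.value_transport hπ θ₂ ρ ρ' h]
  | _, _, .sub θ₁ θ₂, ρ, ρ', h, ν => by
      simp only [IFPTerm.value, IFPTerm.value_transport hπ θ₁ ρ ρ' h,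
        IFPTerm.value_transport hπ θ₂ ρ ρ' h]
  | _, _, .mul θ₁ θ₂, ρ, ρ', h, ν => by
      simp only [IFPTerm.value, IFPTerm.value_transport hπ θ₁ ρ ρ' h,
        IFPTerm.value_transport hπ θ₂ ρ ρ' h]
  | _, _, .div θ₁ θ₂, ρ, ρ', h, ν => by
      simp only [IFPTerm.value, IFPTerm.value_transport hπ θ₁ ρ ρ' h,
        IFPTerm.value_transport hπ θ₂ ρ ρ' h]
  | _, _, .cond φ θ₁ θ₂, ρ, ρ', h, ν => by
      simp only [IFPTerm.value, IFPTerm.value_transport hπ θ₁ ρ ρ' h,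
        IFPTerm.value_transport hπ θ₂ ρ ρ' h]
      exact if_congr (IFPFormula.holds_transport hπ φ ρ ρ' h ν) rfl rfl
  | _, _, .sum k φ θ, ρ, ρ', h, ν => by
      simp only [IFPTerm.value]
      refine (Fintype.sum_equiv (Equiv.arrowCongr (Equiv.refl (Fin k)) π) _ _ fun a => ?_).symm
      have e : Fin.append (π ∘ ν) ((Equiv.arrowCongr (Equiv.refl (Fin k)) π) a) =
          π ∘ Fin.append ν a := by rw [comp_append]; rfl
      rw [e]
      simp only [IFPTerm.value_transport hπ θ ρ ρ' h]
      exact if_congr (IFPFormula.holds_transport hπ φ ρ ρ' h _).symm rfl rfl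
  | _, _, .ifp k θ x, ρ, ρ', h, ν => by
      simp only [IFPTerm.value]
      refine ifpLimit_transport (Equiv.arrowCongr (Equiv.refl (Fin k)) π) _ _
        (fun f f' hf a => ?_) (fun i => ν (x i))
      rw [← IFPTerm.value_transport hπ θ _ _ (h.cons (f := f) (f' := f') hf), comp_append]
      rfl

end

end Isomorphism

section Tame

/-- A sequence of propositions whose truth value is eventually constant. -/
def Decided (P : ℕ → Prop) : Prop :=
  (∀ᶠ K in atTop, P K) ∨ ∀ᶠ K in atTop, ¬ P K

/-- A sequence in `ℝ ∪ {⊥}` that is eventually `⊥` or eventually a rational function. -/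
def Tame (f : ℕ → WithBot ℝ) : Prop :=
  (∀ᶠ K in atTop, f K = ⊥) ∨ ∃ p q : ℝ[X], q ≠ 0 ∧
    ∀ᶠ K : ℕ in atTop, f K = ((p.eval (K : ℝ) / q.eval (K : ℝ) : ℝ) : WithBot ℝ)

theorem Decided.of_eventually_iff {P Q : ℕ → Prop} (hQ : Decided Q)
    (h : ∀ᶠ K in atTop, (P K ↔ Q K)) : Decided P := by
  rcases hQ with hQ | hQ
  · exact .inl (by filter_upwards [h, hQ] with K h1 h2 using h1.2 h2)
  · exact .inr (by filter_upwards [h, hQ] with K h1 h2 using fun h3 => h2 (h1.1 h3))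

theorem Decided.not {P : ℕ → Prop} (h : Decided P) : Decided fun K => ¬ P K := by
  rcases h with h | h
  · exact .inr (by simpa using h)
  · exact .inl h

theorem Decided.and {P Q : ℕ → Prop} (hP : Decided P) (hQ : Decided Q) :
    Decided fun K => P K ∧ Q K := by
  rcases hP with hP | hP
  · exact hQ.of_eventually_iff (by filter_upwards [hP] with K h using by simp [h])
  · exact .inr (by filter_upwards [hP] with K h using by simp [h])

theorem Decided.or {P Q : ℕ → Prop} (hP : Decided P) (hQ : Decided Q) :
    Decided fun K => P K ∨ Q K :=
  (hP.not.and hQ.not).not.of_eventually_iff (.of_forall fun K => by tauto)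

theorem Decided.imp {P Q : ℕ → Prop} (hP : Decided P) (hQ : Decided Q) :
    Decided fun K => P K → Q K :=
  (hP.not.or hQ).of_eventually_iff (.of_forall fun K => by tauto)

theorem Decided.exists_finset {ι : Type} {P : ι → ℕ → Prop} (s : Finset ι)
    (h : ∀ i ∈ s, Decided (P i)) : Decided fun K => ∃ i ∈ s, P i K := by
  classical
  induction s using Finset.induction_on with
  | empty => exact .inr (by simp)
  | insert i s hi ih =>
    exact ((h i (by simp)).or (ih fun j hj => h j (by simp [hj]))).of_eventually_iff
      (.of_forall fun K => by simp)

theorem Polynomial.decided_nonneg (p : ℝ[X]) : Decided fun K : ℕ => 0 ≤ p.eval (K : ℝ) := by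
  by_cases hd : 0 < p.degree
  · rcases le_total 0 p.leadingCoeff with hl | hl
    · exact .inl ((tendsto_natCast_atTop_atTop.eventually
        ((p.tendsto_atTop_of_leadingCoeff_nonneg hd hl).eventually_ge_atTop 0)))
    · refine .inr ((tendsto_natCast_atTop_atTop.eventually
        ((p.tendsto_atBot_of_leadingCoeff_nonpos hd hl).eventually_lt_atBot 0)).mono ?_)
      intro K hK
      exact not_le.2 hK
  · rw [eq_C_of_degree_le_zero (not_lt.1 hd)]
    by_cases h : 0 ≤ p.coeff 0
    · exact .inl (by simp [h])
    · exact .inr (by simpa using ⟨0, fun _ _ => not_le.1 h⟩)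

theorem Polynomial.eventually_eval_natCast_ne_zero {q : ℝ[X]} (hq : q ≠ 0) :
    ∀ᶠ K : ℕ in atTop, q.eval (K : ℝ) ≠ 0 := by
  have h : ∀ᶠ x : ℝ in atTop, ¬ q.IsRoot x := q.eventually_atTop_not_isRoot hq
  exact tendsto_natCast_atTop_atTop.eventually h

theorem Tame.congr {f g : ℕ → WithBot ℝ} (hg : Tame g) (h : ∀ᶠ K in atTop, f K = g K) :
    Tame f := by
  rcases hg with hg | ⟨p, q, hq, hg⟩
  · exact .inl (by filter_upwards [h, hg] with K h1 h2 using h1.trans h2)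
  · exact .inr ⟨p, q, hq, by filter_upwards [h, hg] with K h1 h2 using h1.trans h2⟩

theorem Tame.bot : Tame fun _ => ⊥ := .inl (.of_forall fun _ => rfl)

theorem Tame.coe (r : ℝ) : Tame fun _ => (r : WithBot ℝ) :=
  .inr ⟨C r, 1, one_ne_zero, .of_forall fun _ => by simp⟩

theorem Tame.const (r : WithBot ℝ) : Tame fun _ => r := by
  cases r with
  | bot => exact .bot
  | coe r => exact .coe r

theorem Tame.decided_eq_bot {f : ℕ → WithBot ℝ} (hf : Tame f) : Decided fun K => f K = ⊥ := by
  rcases hf with hf | ⟨p, q, hq, hf⟩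
  · exact .inl hf
  · exact .inr (by filter_upwards [hf] with K h using by simp [h])

theorem Tame.ite {P : ℕ → Prop} [∀ K, Decidable (P K)] {f g : ℕ → WithBot ℝ} (hP : Decided P)
    (hf : Tame f) (hg : Tame g) : Tame fun K => if P K then f K else g K := by
  rcases hP with hP | hP
  · exact hf.congr (by filter_upwards [hP] with K h using by simp [h])
  · exact hg.congr (by filter_upwards [hP] with K h using by simp [h])

theorem Tame.decided_le {f g : ℕ → WithBot ℝ} (hf : Tame f) (hg : Tame g) :
    Decided fun K => f K ≤ g K := by
  rcases hf with hf | ⟨p, q, hq, hf⟩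
  · exact .inl (by filter_upwards [hf] with K h using by simp [h])
  rcases hg with hg | ⟨p', q', hq', hg⟩
  · exact .inr (by filter_upwards [hf, hg] with K h h' using by simp [h, h'])
  refine (Polynomial.decided_nonneg ((p' * q - p * q') * (q * q'))).of_eventually_iff ?_
  filter_upwards [hf, hg, eventually_eval_natCast_ne_zero hq, eventually_eval_natCast_ne_zero hq']
    with K h h' h0 h0'
  rw [h, h', WithBot.coe_le_coe, ← sub_nonneg, div_sub_div _ _ h0' h0, div_nonneg_iff, ← mul_nonneg_iff]
  simp only [eval_mul, eval_sub]
  ring_nf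

theorem botLift_bot_right (op : ℝ → ℝ → WithBot ℝ) (x : WithBot ℝ) : botLift op x ⊥ = ⊥ := by
  cases x <;> rfl

theorem Tame.of_botLift {op : ℝ → ℝ → WithBot ℝ} {f g : ℕ → WithBot ℝ}
    (hop : ∀ p q p' q' : ℝ[X], q ≠ 0 → q' ≠ 0 → Tame fun K : ℕ =>
      op (p.eval (K : ℝ) / q.eval (K : ℝ)) (p'.eval (K : ℝ) / q'.eval (K : ℝ)))
    (hf : Tame f) (hg : Tame g) : Tame fun K => botLift op (f K) (g K) := by
  rcases hf with hf | ⟨p, q, hq, hf⟩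
  · exact .inl (by filter_upwards [hf] with K h using by rw [h]; rfl)
  rcases hg with hg | ⟨p', q', hq', hg⟩
  · exact .inl (by filter_upwards [hg] with K h using by rw [h, botLift_bot_right])
  exact (hop p q p' q' hq hq').congr
    (by filter_upwards [hf, hg] with K h h' using by rw [h, h']; rfl)

theorem Tame.add_lift {f g : ℕ → WithBot ℝ} (hf : Tame f) (hg : Tame g) :
    Tame fun K => botLift (fun x y => ((x + y : ℝ) : WithBot ℝ)) (f K) (g K) := by
  refine hf.of_botLift (fun p q p' q' hq hq' => .inr ⟨p * q' + q * p', q * q', mul_ne_zero hq hq', ?_⟩) hg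
  filter_upwards [eventually_eval_natCast_ne_zero hq, eventually_eval_natCast_ne_zero hq']
    with K h h'
  simp [div_add_div _ _ h h']

theorem Tame.sub_lift {f g : ℕ → WithBot ℝ} (hf : Tame f) (hg : Tame g) :
    Tame fun K => botLift (fun x y => ((x - y : ℝ) : WithBot ℝ)) (f K) (g K) := by
  refine hf.of_botLift (fun p q p' q' hq hq' => .inr ⟨p * q' - q * p', q * q', mul_ne_zero hq hq', ?_⟩) hg
  filter_upwards [eventually_eval_natCast_ne_zero hq, eventually_eval_natCast_ne_zero hq']
    with K h h'
  simp [div_sub_div _ _ h h']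

theorem Tame.mul_lift {f g : ℕ → WithBot ℝ} (hf : Tame f) (hg : Tame g) :
    Tame fun K => botLift (fun x y => ((x * y : ℝ) : WithBot ℝ)) (f K) (g K) := by
  refine hf.of_botLift (fun p q p' q' hq hq' => .inr ⟨p * p', q * q', mul_ne_zero hq hq', ?_⟩) hg
  exact .of_forall fun K => by simp [div_mul_div_comm]

open Classical in
theorem Tame.div_lift {f g : ℕ → WithBot ℝ} (hf : Tame f) (hg : Tame g) :
    Tame fun K => botLift (fun x y => if y = 0 then ⊥ else ((x / y : ℝ) : WithBot ℝ))
      (f K) (g K) := by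
  refine hf.of_botLift (fun p q p' q' hq hq' => ?_) hg
  by_cases hp' : p' = 0
  · exact .inl (by simp [hp'])
  refine .inr ⟨p * q', q * p', mul_ne_zero hq hp', ?_⟩
  filter_upwards [eventually_eval_natCast_ne_zero hp', eventually_eval_natCast_ne_zero hq']
    with K h h'
  rw [if_neg (div_ne_zero h h'), div_div_div_eq]
  simp

theorem Tame.add {f g : ℕ → WithBot ℝ} (hf : Tame f) (hg : Tame g) : Tame fun K => f K + g K := by
  refine (hf.add_lift hg).congr (.of_forall fun K => ?_)
  cases f K <;> cases g K <;> rfl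

theorem Tame.sum {ι : Type} {f : ι → ℕ → WithBot ℝ} (s : Finset ι) (h : ∀ i ∈ s, Tame (f i)) :
    Tame fun K => ∑ i ∈ s, f i K := by
  classical
  induction s using Finset.induction_on with
  | empty => simpa using Tame.coe 0
  | insert i s hi ih =>
    simp only [Finset.sum_insert hi]
    exact (h i (by simp)).add (ih fun j hj => h j (by simp [hj]))

theorem Tame.nsmul {f : ℕ → WithBot ℝ} (hf : Tame f) (c h : ℕ) :
    Tame fun K => (K + c - h) • f K := by
  rcases hf with hf | ⟨p, q, hq, hf⟩
  · refine .inl ?_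
    filter_upwards [hf, eventually_gt_atTop h] with K hK hlt
    obtain ⟨m, hm⟩ : ∃ m, K + c - h = m + 1 := ⟨K + c - h - 1, by omega⟩
    rw [hK, hm, succ_nsmul, WithBot.add_bot]
  · refine .inr ⟨(X + C ((c : ℝ) - h)) * p, q, hq, ?_⟩
    filter_upwards [hf, eventually_gt_atTop h] with K hK hlt
    rw [hK, ← WithBot.coe_nsmul, nsmul_eq_mul, Nat.cast_sub (by omega)]
    congr 1
    simp
    ring

end Tame

section Orbits

/-- The element of `Fin (K + 3)` named by a natural number. -/
def nameElem (K : ℕ) (i : ℕ) : Fin (K + 3) := Fin.ofNat (K + 3) i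

theorem nameElem_inj {K i j : ℕ} (hi : i < K + 3) (hj : j < K + 3) :
    nameElem K i = nameElem K j ↔ i = j := by
  simp [nameElem, Fin.ext_iff, Nat.mod_eq_of_lt hi, Nat.mod_eq_of_lt hj]

/-- The permutation `π` fixes the elements named in `F`. -/
def FixesNamed (F : Finset ℕ) (K : ℕ) (π : Equiv.Perm (Fin (K + 3))) : Prop :=
  ∀ i ∈ F, π (nameElem K i) = nameElem K i

theorem FixesNamed.mono {F F' : Finset ℕ} {K : ℕ} {π : Equiv.Perm (Fin (K + 3))}
    (h : FixesNamed F' K π) (hF : F ⊆ F') : FixesNamed F K π :=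
  fun i hi => h i (hF hi)

theorem FixesNamed.comp {F : Finset ℕ} {K : ℕ} {π : Equiv.Perm (Fin (K + 3))}
    (h : FixesNamed F K π) {n : ℕ} {ν : Fin n → ℕ} (hν : ∀ i, ν i ∈ F) :
    π ∘ nameElem K ∘ ν = nameElem K ∘ ν :=
  funext fun i => h _ (hν i)

theorem eventually_nameElem_inj (F : Finset ℕ) :
    ∀ᶠ K in atTop, ∀ i ∈ F, ∀ j ∈ F, nameElem K i = nameElem K j → i = j := by
  filter_upwards [eventually_gt_atTop (F.sup id)] with K hK i hi j hj h
  have h1 : i ≤ F.sup id := Finset.le_sup (f := id) hi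
  have h2 : j ≤ F.sup id := Finset.le_sup (f := id) hj
  exact (nameElem_inj (by omega) (by omega)).1 h

theorem exists_fixesNamed_apply_eq {F : Finset ℕ} {m : ℕ} (hm : m ∉ F) : ∀ᶠ K in atTop,
    ∀ x : Fin (K + 3), x ∉ F.image (nameElem K) →
      ∃ π, FixesNamed F K π ∧ π x = nameElem K m := by
  filter_upwards [eventually_nameElem_inj (insert m F)] with K hK x hx
  refine ⟨Equiv.swap x (nameElem K m), fun i hi => Equiv.swap_apply_of_ne_of_ne ?_ ?_, by simp⟩
  · rintro rfl
    exact hx (Finset.mem_image_of_mem _ hi)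
  · intro h
    have := hK i (by simp [hi]) m (by simp) h
    exact hm (this ▸ hi)

theorem exists_named_representative {F : Finset ℕ} {m : ℕ} (hm : m ∉ F) : ∀ᶠ K in atTop,
    ∀ x : Fin (K + 3), ∃ s ∈ insert m F, ∃ π, FixesNamed F K π ∧ π x = nameElem K s := by
  filter_upwards [exists_fixesNamed_apply_eq hm] with K hK x
  by_cases hx : x ∈ F.image (nameElem K)
  · obtain ⟨s, hs, rfl⟩ := Finset.mem_image.1 hx
    exact ⟨s, by simp [hs], 1, fun _ _ => rfl, rfl⟩
  · exact ⟨m, by simp, hK x hx⟩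

theorem comp_cons {A B : Type} (f : A → B) {k : ℕ} (x : A) (a : Fin k → A) :
    f ∘ (Fin.cons x a : Fin (k + 1) → A) = Fin.cons (f x) (f ∘ a) := by
  funext i
  refine Fin.cases ?_ (fun i => ?_) i <;> simp

theorem exists_tuple_representatives (k : ℕ) (F : Finset ℕ) : ∃ R : Finset (Fin k → ℕ),
    ∀ᶠ K in atTop, ∀ a : Fin k → Fin (K + 3),
      ∃ b ∈ R, ∃ π, FixesNamed F K π ∧ π ∘ a = nameElem K ∘ b := by
  classical
  induction k generalizing F with
  | zero =>
    exact ⟨{Fin.elim0}, .of_forall fun K a =>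
      ⟨_, Finset.mem_singleton_self _, 1, fun _ _ => rfl, Subsingleton.elim _ _⟩⟩
  | succ k ih =>
    obtain ⟨m, hm⟩ := F.exists_notMem
    choose R hR using fun s : ℕ => ih (insert s F)
    refine ⟨(insert m F).biUnion fun s => (R s).image fun b => (Fin.cons s b : Fin (k + 1) → ℕ), ?_⟩
    have hall : ∀ᶠ K in atTop, ∀ s ∈ insert m F, ∀ a : Fin k → Fin (K + 3),
        ∃ b ∈ R s, ∃ π, FixesNamed (insert s F) K π ∧ π ∘ a = nameElem K ∘ b :=
      (Finset.eventually_all _).2 fun s _ => hR s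
    filter_upwards [exists_named_representative hm, hall] with K h1 h2 a
    obtain ⟨s, hs, π, hπ, hπs⟩ := h1 (a 0)
    obtain ⟨b, hb, π', hπ', hb'⟩ := h2 s hs (π ∘ Fin.tail a)
    refine ⟨Fin.cons s b, Finset.mem_biUnion.2 ⟨s, hs, Finset.mem_image_of_mem _ hb⟩, π' * π,
      fun i hi => ?_, ?_⟩
    · rw [Equiv.Perm.mul_apply, hπ i hi, hπ' i (by simp [hi])]
    · rw [comp_cons, ← hb', ← Fin.cons_self_tail a, comp_cons]
      congr 1
      rw [Equiv.Perm.mul_apply, hπs, hπ' s (by simp)]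

/-- A family of functions of tuples that is invariant under the permutations fixing `F`. -/
def NamedInvariant {β : Type} (F : Finset ℕ) {k : ℕ} (g : ∀ K, (Fin k → Fin (K + 3)) → β) : Prop :=
  ∀ K π, FixesNamed F K π → ∀ a, g K (π ∘ a) = g K a

theorem Decided.exists_elem {F : Finset ℕ} {P : ∀ K, Fin (K + 3) → Prop}
    (hinv : ∀ K π, FixesNamed F K π → ∀ x, (P K (π x) ↔ P K x))
    (h : ∀ i, Decided fun K => P K (nameElem K i)) : Decided fun K => ∃ x, P K x := by
  obtain ⟨m, hm⟩ := F.exists_notMem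
  refine (Decided.exists_finset (insert m F) fun i _ => h i).of_eventually_iff ?_
  filter_upwards [exists_named_representative hm] with K hK
  constructor
  · rintro ⟨x, hx⟩
    obtain ⟨s, hs, π, hπ, hs'⟩ := hK x
    exact ⟨s, hs, by rwa [← hs', hinv K π hπ]⟩
  · rintro ⟨s, -, hs⟩
    exact ⟨_, hs⟩

theorem Tame.sum_elem {F : Finset ℕ} {g : ∀ K, Fin (K + 3) → WithBot ℝ}
    (hinv : ∀ K π, FixesNamed F K π → ∀ x, g K (π x) = g K x)
    (h : ∀ i, Tame fun K => g K (nameElem K i)) : Tame fun K => ∑ x, g K x := by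
  classical
  obtain ⟨m, hm⟩ := F.exists_notMem
  refine ((Tame.sum F fun i _ => h i).add ((h m).nsmul 3 F.card)).congr ?_
  filter_upwards [exists_fixesNamed_apply_eq hm, eventually_nameElem_inj F] with K hK hinj
  rw [← Finset.sum_add_sum_compl (F.image (nameElem K)), Finset.sum_image hinj]
  congr 1
  rw [Finset.sum_eq_card_nsmul (b := g K (nameElem K m)), Finset.card_compl,
    Finset.card_image_of_injOn hinj, Fintype.card_fin]
  intro x hx
  obtain ⟨π, hπ, hx'⟩ := hK x (Finset.mem_compl.1 hx)
  rw [← hx', hinv K π hπ]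

theorem Tame.sum_tuple (k : ℕ) {F : Finset ℕ} {g : ∀ K, (Fin k → Fin (K + 3)) → WithBot ℝ}
    (hinv : NamedInvariant F g) (h : ∀ b : Fin k → ℕ, Tame fun K => g K (nameElem K ∘ b)) :
    Tame fun K => ∑ a, g K a := by
  induction k generalizing F with
  | zero =>
    refine (h Fin.elim0).congr (.of_forall fun K => ?_)
    rw [Fintype.sum_unique]
    congr 1
    exact Subsingleton.elim _ _
  | succ k ih =>
    have key : ∀ K, ∑ a, g K a = ∑ x : Fin (K + 3), ∑ a : Fin k → Fin (K + 3),
        g K (Fin.cons x a) := by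
      intro K
      rw [← Fintype.sum_prod_type']
      exact ((Fin.consEquiv fun _ : Fin (k + 1) => Fin (K + 3)).sum_comp (g K)).symm
    refine Tame.congr ?_ (.of_forall key)
    refine Tame.sum_elem (F := F) (fun K π hπ x => ?_) fun i => ?_
    · rw [← (Equiv.arrowCongr (Equiv.refl (Fin k)) π).sum_comp]
      refine Finset.sum_congr rfl fun a _ => ?_
      rw [← hinv K π hπ (Fin.cons x a), comp_cons]
      rfl
    · refine ih (F := insert i F) (fun K π hπ a => ?_) fun b => ?_
      · rw [← hinv K π (hπ.mono (by simp)) (Fin.cons _ a), comp_cons, hπ i (by simp)]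
      · refine (h (Fin.cons i b)).congr (.of_forall fun K => ?_)
        rw [comp_cons]

theorem ifpStage_eq_of_le {T : Type} (Φ : (T → WithBot ℝ) → T → WithBot ℝ) {t t' : ℕ} (h : t ≤ t')
    {a : T} (ha : ifpStage Φ t a ≠ ⊥) : ifpStage Φ t' a = ifpStage Φ t a := by
  induction t', h using Nat.le_induction with
  | base => rfl
  | succ t' _ ih =>
    simp only [ifpStage]
    rw [if_neg (by rwa [ih]), ih]

theorem ifpLimit_eq_of_stable {T : Type} {Φ : (T → WithBot ℝ) → T → WithBot ℝ} {t : ℕ}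
    (h : ifpStage Φ (t + 1) = ifpStage Φ t) (a : T) : ifpLimit Φ a = ifpStage Φ t a := by
  have hs : ∀ t', t ≤ t' → ifpStage Φ t' = ifpStage Φ t := by
    intro t' ht'
    induction t', ht' using Nat.le_induction with
    | base => rfl
    | succ t' _ ih =>
      rw [← h]
      funext b
      simp only [ifpStage, ih]
  unfold ifpLimit
  split_ifs with hex
  · have hne := Nat.find_spec hex
    rcases le_total t (Nat.find hex) with hle | hle
    · rw [hs _ hle]
    · exact (ifpStage_eq_of_le Φ hle hne).symm
  · push Not at hex
    exact (hex t).symm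

theorem Tame.ifpLimit {k : ℕ} {F : Finset ℕ}
    {Φ : ∀ K, ((Fin k → Fin (K + 3)) → WithBot ℝ) → (Fin k → Fin (K + 3)) → WithBot ℝ}
    (hΦ : ∀ f : ∀ K, (Fin k → Fin (K + 3)) → WithBot ℝ, NamedInvariant F f →
      (∀ b : Fin k → ℕ, Tame fun K => f K (nameElem K ∘ b)) →
      NamedInvariant F (fun K => Φ K (f K)) ∧
        ∀ b : Fin k → ℕ, Tame fun K => Φ K (f K) (nameElem K ∘ b))
    (b : Fin k → ℕ) : Tame fun K => _root_.ifpLimit (Φ K) (nameElem K ∘ b) := by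
  classical
  have hst : ∀ t, NamedInvariant F (fun K => ifpStage (Φ K) t) ∧
      ∀ b : Fin k → ℕ, Tame fun K => ifpStage (Φ K) t (nameElem K ∘ b) := by
    intro t
    induction t with
    | zero => exact ⟨fun _ _ _ _ => rfl, fun _ => .bot⟩
    | succ t ih =>
      obtain ⟨h1, h2⟩ := hΦ _ ih.1 ih.2
      refine ⟨fun K π hπ a => ?_, fun b => ?_⟩
      · simp only [ifpStage, ih.1 K π hπ a, h1 K π hπ a]
      · exact Tame.ite (ih.2 b).decided_eq_bot (h2 b) (ih.2 b)
  obtain ⟨R, hR⟩ := exists_tuple_representatives k F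
  let D : ℕ →o Set R :=
    { toFun := fun t => {b | ∀ᶠ K in atTop, ifpStage (Φ K) t (nameElem K ∘ b.1) ≠ ⊥}
      monotone' := fun t t' h b (hb : ∀ᶠ K in atTop, _) => by
        change ∀ᶠ K in atTop, _
        filter_upwards [hb] with K hK
        rwa [ifpStage_eq_of_le _ h hK] }
  obtain ⟨t, ht⟩ := WellFoundedGT.monotone_chain_condition D
  have hbot : ∀ᶠ K in atTop, ∀ b ∈ R, ifpStage (Φ K) t (nameElem K ∘ b) = ⊥ →
      ifpStage (Φ K) (t + 1) (nameElem K ∘ b) = ⊥ := by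
    refine (Finset.eventually_all _).2 fun b hb => ?_
    rcases ((hst (t + 1)).2 b).decided_eq_bot with h | h
    · filter_upwards [h] with K hK _ using hK
    · have : (⟨b, hb⟩ : R) ∈ D t := by
        rw [ht (t + 1) (by omega)]
        exact h
      have h' : ∀ᶠ K in atTop, ifpStage (Φ K) t (nameElem K ∘ b) ≠ ⊥ := this
      filter_upwards [h'] with K hK h0 using absurd h0 hK
  refine ((hst t).2 b).congr ?_
  filter_upwards [hR, hbot] with K hK hb
  refine ifpLimit_eq_of_stable (funext fun a => ?_) _
  by_cases ha : ifpStage (Φ K) t a = ⊥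
  · obtain ⟨b', hb', π, hπ, he⟩ := hK a
    have h1 : ifpStage (Φ K) (t + 1) (π ∘ a) = ifpStage (Φ K) (t + 1) a :=
      (hst (t + 1)).1 K π hπ a
    have h2 : ifpStage (Φ K) t (π ∘ a) = ifpStage (Φ K) t a := (hst t).1 K π hπ a
    rw [ha, ← h1, he]
    exact hb b' hb' (by rw [← he, h2, ha])
  · exact ifpStage_eq_of_le _ (by omega) ha

end Orbits

section SymmetricStructures

theorem decided_nameElem_eq (i j : ℕ) : Decided fun K => nameElem K i = nameElem K j := by
  by_cases h : i = j
  · exact .inl (.of_forall fun K => by simp [h])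
  · refine .inr ?_
    filter_upwards [eventually_nameElem_inj {i, j}] with K hK h'
    exact h (hK _ (by simp) _ (by simp) h')

variable {Υ : WVocab}

/-- A sequence of structures on `Fin (K + 3)` that are invariant under all permutations fixing the
elements named in `F₀` and whose relations and weights between named elements are eventually
constant. -/
structure SymmetricFamily (𝔄 : ∀ K, WStructure Υ (Fin (K + 3))) (F₀ : Finset ℕ) : Prop where
  isAut : ∀ K π, FixesNamed F₀ K π → (𝔄 K).IsAut π
  rel : ∀ R (b : Fin (Υ.relArity R) → ℕ), Decided fun K => (𝔄 K).rel R (nameElem K ∘ b)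
  fn : ∀ F (b : Fin (Υ.fnArity F) → ℕ), Tame fun K => (𝔄 K).fn F (nameElem K ∘ b)

/-- A family of environments that is invariant under the permutations fixing `F` and whose values
on named tuples are tame. -/
structure TameEnv (F : Finset ℕ) {Γ : List ℕ} (ρ : ∀ K, FnEnv Γ (Fin (K + 3))) : Prop where
  invariant : ∀ K π, FixesNamed F K π → FnEnv.Transport π (ρ K) (ρ K)
  tame : ∀ k (X : FnVar Γ k) (b : Fin k → ℕ), Tame fun K => ρ K k X (nameElem K ∘ b)

theorem TameEnv.mono {F F' : Finset ℕ} {Γ : List ℕ} {ρ : ∀ K, FnEnv Γ (Fin (K + 3))}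
    (h : TameEnv F ρ) (hF : F ⊆ F') : TameEnv F' ρ :=
  ⟨fun K π hπ => h.invariant K π (hπ.mono hF), h.tame⟩

theorem TameEnv.cons {F : Finset ℕ} {Γ : List ℕ} {ρ : ∀ K, FnEnv Γ (Fin (K + 3))}
    (h : TameEnv F ρ) {k : ℕ} {f : ∀ K, (Fin k → Fin (K + 3)) → WithBot ℝ}
    (hf : NamedInvariant F f) (hf' : ∀ b : Fin k → ℕ, Tame fun K => f K (nameElem K ∘ b)) :
    TameEnv F fun K => FnEnv.cons (f K) (ρ K) where
  invariant K π hπ := (h.invariant K π hπ).cons (hf K π hπ)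
  tame
    | _, .zero, b => hf' b
    | l, .succ X, b => h.tame l X b

variable {𝔄 : ∀ K, WStructure Υ (Fin (K + 3))} {F₀ : Finset ℕ}

theorem SymmetricFamily.holds_append (h𝔄 : SymmetricFamily 𝔄 F₀) {F : Finset ℕ} (hF : F₀ ⊆ F)
    {Γ : List ℕ} {n k : ℕ} (φ : IFPFormula Υ Γ (n + k)) {ρ : ∀ K, FnEnv Γ (Fin (K + 3))}
    (hρ : TameEnv F ρ) {ν : Fin n → ℕ} (hν : ∀ i, ν i ∈ F) {K : ℕ} {π : Equiv.Perm (Fin (K + 3))}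
    (hπ : FixesNamed F K π) (a : Fin k → Fin (K + 3)) :
    φ.Holds (𝔄 K) (ρ K) (Fin.append (nameElem K ∘ ν) (π ∘ a)) ↔
      φ.Holds (𝔄 K) (ρ K) (Fin.append (nameElem K ∘ ν) a) := by
  rw [← IFPFormula.holds_transport (h𝔄.isAut K π (hπ.mono hF)) φ _ _ (hρ.invariant K π hπ)
    (Fin.append _ a), comp_append, hπ.comp hν]

theorem SymmetricFamily.value_append (h𝔄 : SymmetricFamily 𝔄 F₀) {F : Finset ℕ} (hF : F₀ ⊆ F)
    {Γ : List ℕ} {n k : ℕ} (θ : IFPTerm Υ Γ (n + k)) {ρ : ∀ K, FnEnv Γ (Fin (K + 3))}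
    (hρ : TameEnv F ρ) {ν : Fin n → ℕ} (hν : ∀ i, ν i ∈ F) {K : ℕ} {π : Equiv.Perm (Fin (K + 3))}
    (hπ : FixesNamed F K π) (a : Fin k → Fin (K + 3)) :
    θ.value (𝔄 K) (ρ K) (Fin.append (nameElem K ∘ ν) (π ∘ a)) =
      θ.value (𝔄 K) (ρ K) (Fin.append (nameElem K ∘ ν) a) := by
  rw [← IFPTerm.value_transport (h𝔄.isAut K π (hπ.mono hF)) θ _ _ (hρ.invariant K π hπ)
    (Fin.append _ a), comp_append, hπ.comp hν]

theorem SymmetricFamily.decided_exists (h𝔄 : SymmetricFamily 𝔄 F₀) {F : Finset ℕ} (hF : F₀ ⊆ F)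
    {Γ : List ℕ} {n : ℕ} (φ : IFPFormula Υ Γ (n + 1)) {ρ : ∀ K, FnEnv Γ (Fin (K + 3))}
    (hρ : TameEnv F ρ) (ν : Fin n → ℕ)
    (h : ∀ ν : Fin (n + 1) → ℕ, Decided fun K => φ.Holds (𝔄 K) (ρ K) (nameElem K ∘ ν)) :
    Decided fun K => ∃ a, φ.Holds (𝔄 K) (ρ K) (Fin.append (nameElem K ∘ ν) fun _ : Fin 1 => a) := by
  classical
  have hsub : F ⊆ F ∪ Finset.univ.image ν := Finset.subset_union_left
  refine Decided.exists_elem (F := F ∪ Finset.univ.image ν) (fun K π hπ x => ?_) fun i => ?_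
  · exact h𝔄.holds_append (hF.trans hsub) φ (hρ.mono hsub) (by simp) hπ fun _ => x
  · refine (h (Fin.append ν fun _ => i)).of_eventually_iff (.of_forall fun K => ?_)
    rw [comp_append]
    rfl

open Classical in
mutual

theorem SymmetricFamily.decided_holds (h𝔄 : SymmetricFamily 𝔄 F₀) : {Γ : List ℕ} → {n : ℕ} →
    (φ : IFPFormula Υ Γ n) → (F : Finset ℕ) → F₀ ⊆ F → (ρ : ∀ K, FnEnv Γ (Fin (K + 3))) →
    TameEnv F ρ → (ν : Fin n → ℕ) → Decided fun K => φ.Holds (𝔄 K) (ρ K) (nameElem K ∘ ν)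
  | _, _, .eq x y, F, hF, ρ, hρ, ν => by
      simp only [IFPFormula.Holds]
      exact decided_nameElem_eq _ _
  | _, _, .rel R x, F, hF, ρ, hρ, ν => by
      simp only [IFPFormula.Holds]
      exact h𝔄.rel R fun i => ν (x i)
  | _, _, .le θ₁ θ₂, F, hF, ρ, hρ, ν => by
      simp only [IFPFormula.Holds]
      exact (h𝔄.tame_value θ₁ F hF ρ hρ ν).decided_le (h𝔄.tame_value θ₂ F hF ρ hρ ν)
  | _, _, .not φ, F, hF, ρ, hρ, ν => by
      simp only [IFPFormula.Holds]
      exact (h𝔄.decided_holds φ F hF ρ hρ ν).not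
  | _, _, .or φ ψ, F, hF, ρ, hρ, ν => by
      simp only [IFPFormula.Holds]
      exact (h𝔄.decided_holds φ F hF ρ hρ ν).or (h𝔄.decided_holds ψ F hF ρ hρ ν)
  | _, _, .and φ ψ, F, hF, ρ, hρ, ν => by
      simp only [IFPFormula.Holds]
      exact (h𝔄.decided_holds φ F hF ρ hρ ν).and (h𝔄.decided_holds ψ F hF ρ hρ ν)
  | _, _, .imp φ ψ, F, hF, ρ, hρ, ν => by
      simp only [IFPFormula.Holds]
      exact (h𝔄.decided_holds φ F hF ρ hρ ν).imp (h𝔄.decided_holds ψ F hF ρ hρ ν)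
  | _, _, .ex φ, F, hF, ρ, hρ, ν => by
      simp only [IFPFormula.Holds]
      exact h𝔄.decided_exists hF φ hρ ν fun ν => h𝔄.decided_holds φ F hF ρ hρ ν
  | _, n, .all φ, F, hF, ρ, hρ, ν => by
      simp only [IFPFormula.Holds]
      have h := (h𝔄.decided_exists hF (.not φ) hρ ν fun ν => by
        simp only [IFPFormula.Holds]
        exact (h𝔄.decided_holds φ F hF ρ hρ ν).not).not
      simpa only [IFPFormula.Holds, not_exists, not_not] using h

theorem SymmetricFamily.tame_value (h𝔄 : SymmetricFamily 𝔄 F₀) : {Γ : List ℕ} → {n : ℕ} →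
    (θ : IFPTerm Υ Γ n) → (F : Finset ℕ) → F₀ ⊆ F → (ρ : ∀ K, FnEnv Γ (Fin (K + 3))) →
    TameEnv F ρ → (ν : Fin n → ℕ) → Tame fun K => θ.value (𝔄 K) (ρ K) (nameElem K ∘ ν)
  | _, _, .const r, F, hF, ρ, hρ, ν => by
      simp only [IFPTerm.value]
      exact .const _
  | _, _, .fn G x, F, hF, ρ, hρ, ν => by
      simp only [IFPTerm.value]
      exact h𝔄.fn G fun i => ν (x i)
  | _, _, .ifn X x, F, hF, ρ, hρ, ν => by
      simp only [IFPTerm.value]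
      exact hρ.tame _ X fun i => ν (x i)
  | _, _, .add θ₁ θ₂, F, hF, ρ, hρ, ν => by
      simp only [IFPTerm.value]
      exact (h𝔄.tame_value θ₁ F hF ρ hρ ν).add_lift (h𝔄.tame_value θ₂ F hF ρ hρ ν)
  | _, _, .sub θ₁ θ₂, F, hF, ρ, hρ, ν => by
      simp only [IFPTerm.value]
      exact (h𝔄.tame_value θ₁ F hF ρ hρ ν).sub_lift (h𝔄.tame_value θ₂ F hF ρ hρ ν)
  | _, _, .mul θ₁ θ₂, F, hF, ρ, hρ, ν => by
      simp only [IFPTerm.value]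
      exact (h𝔄.tame_value θ₁ F hF ρ hρ ν).mul_lift (h𝔄.tame_value θ₂ F hF ρ hρ ν)
  | _, _, .div θ₁ θ₂, F, hF, ρ, hρ, ν => by
      simp only [IFPTerm.value]
      exact (h𝔄.tame_value θ₁ F hF ρ hρ ν).div_lift (h𝔄.tame_value θ₂ F hF ρ hρ ν)
  | _, _, .cond φ θ₁ θ₂, F, hF, ρ, hρ, ν => by
      simp only [IFPTerm.value]
      exact .ite (h𝔄.decided_holds φ F hF ρ hρ ν) (h𝔄.tame_value θ₁ F hF ρ hρ ν)
        (h𝔄.tame_value θ₂ F hF ρ hρ ν)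
  | _, _, .sum k φ θ, F, hF, ρ, hρ, ν => by
      simp only [IFPTerm.value]
      have hsub : F ⊆ F ∪ Finset.univ.image ν := Finset.subset_union_left
      have hν : ∀ i, ν i ∈ F ∪ Finset.univ.image ν := by simp
      refine Tame.sum_tuple k (F := F ∪ Finset.univ.image ν) (fun K π hπ a => ?_) fun b => ?_
      · rw [h𝔄.value_append (hF.trans hsub) θ (hρ.mono hsub) hν hπ]
        exact if_congr (h𝔄.holds_append (hF.trans hsub) φ (hρ.mono hsub) hν hπ a) rfl rfl
      · simp only [← comp_append]
        exact .ite (h𝔄.decided_holds φ F hF ρ hρ _) (h𝔄.tame_value θ F hF ρ hρ _) (.coe 0)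
  | _, _, .ifp k θ x, F, hF, ρ, hρ, ν => by
      simp only [IFPTerm.value]
      have hsub : F ⊆ F ∪ Finset.univ.image ν := Finset.subset_union_left
      have hν : ∀ i, ν i ∈ F ∪ Finset.univ.image ν := by simp
      refine Tame.ifpLimit (F := F ∪ Finset.univ.image ν) (fun f hf hf' => ?_) fun i => ν (x i)
      have hρ' := (hρ.mono hsub).cons hf hf'
      refine ⟨fun K π hπ a => ?_, fun b => ?_⟩
      · exact h𝔄.value_append (hF.trans hsub) θ hρ' hν hπ a
      · simp only [← comp_append]
        exact h𝔄.tame_value θ _ (hF.trans hsub) _ hρ' _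

end

theorem SymmetricFamily.decided_models (h𝔄 : SymmetricFamily 𝔄 F₀) (φ : IFPSentence Υ) :
    Decided fun K => (𝔄 K).Models φ := by
  refine (h𝔄.decided_holds φ F₀ subset_rfl (fun K => FnEnv.nil _)
    ⟨fun _ _ _ _ X => (nomatch X), fun _ X => (nomatch X)⟩ Fin.elim0).of_eventually_iff
    (.of_forall fun K => ?_)
  rw [WStructure.Models, Subsingleton.elim (nameElem K ∘ Fin.elim0) Fin.elim0]

end SymmetricStructures

section StarNetworks

open Classical in
/-- The network with input node `0`, output node `1`, and `K + 1` hidden nodes, each of them joined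
to both; all weights are `1` and all biases are `0`. -/
noncomputable def starNet (K : ℕ) : FNN 1 1 ℝ where
  V := Fin (K + 3)
  E u v := (u = 0 ∧ v ≠ 0 ∧ v ≠ 1) ∨ (u ≠ 0 ∧ u ≠ 1 ∧ v = 1)
  inp _ := 0
  out _ := 1
  bias _ := 0
  weight u v := if (u = 0 ∧ v ≠ 0 ∧ v ≠ 1) ∨ (u ≠ 0 ∧ u ≠ 1 ∧ v = 1) then 1 else 0
  acyclic v h := by
    have key : ∀ u v : Fin (K + 3), Relation.TransGen (fun u v : Fin (K + 3) =>
        (u = 0 ∧ v ≠ 0 ∧ v ≠ 1) ∨ (u ≠ 0 ∧ u ≠ 1 ∧ v = 1)) u v → u = 0 ∧ v ≠ 0 ∨ u ≠ 1 ∧ u ≠ 0 ∧ v = 1 := by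
      intro u v h
      induction h with
      | single h => tauto
      | tail _ h ih =>
        have : (1 : Fin (K + 3)) ≠ 0 := by simp
        rcases h with ⟨rfl, h1, h2⟩ | ⟨h1, h2, rfl⟩
        · simp at ih
        · rcases ih with ⟨rfl, -⟩ | ⟨-, -, rfl⟩
          · simp
          · exact absurd rfl h2
    rcases key v v h with ⟨h1, h2⟩ | ⟨h1, h2, h3⟩
    · exact h2 h1
    · exact h1 h3
  inp_injective := Function.injective_of_subsingleton _
  out_injective := Function.injective_of_subsingleton _
  inp_ne_out i j := by simp
  source_iff v := by
    have h2 : (2 : Fin (K + 3)) ≠ 0 := by simp [Fin.ext_iff, Nat.mod_eq_of_lt (show 2 < K + 3 by omega)]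
    have h21 : (2 : Fin (K + 3)) ≠ 1 := by simp [Fin.ext_iff, Nat.mod_eq_of_lt (show 2 < K + 3 by omega)]
    constructor
    · intro h
      by_contra h'
      have h0 : v ≠ 0 := fun e => h' ⟨0, e.symm⟩
      by_cases h1 : v = 1
      · exact h 2 (.inr ⟨h2, h21, h1⟩)
      · exact h 0 (.inl ⟨rfl, h0, h1⟩)
    · rintro ⟨-, rfl⟩ u
      simp
  sink_iff v := by
    have h2 : (2 : Fin (K + 3)) ≠ 0 := by simp [Fin.ext_iff, Nat.mod_eq_of_lt (show 2 < K + 3 by omega)]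
    have h21 : (2 : Fin (K + 3)) ≠ 1 := by simp [Fin.ext_iff, Nat.mod_eq_of_lt (show 2 < K + 3 by omega)]
    constructor
    · intro h
      by_contra h'
      have h1 : v ≠ 1 := fun e => h' ⟨0, e.symm⟩
      by_cases h0 : v = 0
      · exact h 2 (.inl ⟨h0, h2, h21⟩)
      · exact h 1 (.inr ⟨h0, h1, rfl⟩)
    · rintro ⟨-, rfl⟩ u
      simp
  bias_inp _ := rfl
  weight_of_not_edge u v h := if_neg h

theorem starNet_zeroOneWeights (K : ℕ) : (starNet K).ZeroOneWeights :=
  ⟨fun _ _ => .inl rfl, fun _ _ h => .inr (if_pos h)⟩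

theorem FNN.nodeValue_inp {m p : ℕ} (N : FNN m p ℝ) (x : Fin m → ℝ) (i : Fin m) :
    N.nodeValue x (N.inp i) = x i := by
  have h : ∃ j, N.inp j = N.inp i := ⟨i, rfl⟩
  rw [nodeValue, WellFounded.fix_eq, dif_pos h, N.inp_injective h.choose_spec]

/-- The weighted sum of the values of the predecessors of a node. -/
noncomputable def FNN.preactivation {m p : ℕ} (N : FNN m p ℝ) (x : Fin m → ℝ) (u : N.V) : ℝ :=
  N.bias u + ∑ v, N.weight v u * N.nodeValue x v

theorem FNN.preactivation_eq {m p : ℕ} (N : FNN m p ℝ) (x : Fin m → ℝ) (u : N.V)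
    [∀ v, Decidable (N.E v u)] :
    N.bias u + (∑ v, if N.E v u then N.weight v u * N.nodeValue x v else 0) =
      N.preactivation x u := by
  unfold preactivation
  congr 1
  refine Finset.sum_congr rfl fun v _ => ?_
  split_ifs with h
  · rfl
  · rw [N.weight_of_not_edge v u h, zero_mul]

theorem FNN.nodeValue_out {m p : ℕ} (N : FNN m p ℝ) (x : Fin m → ℝ) (j : Fin p) :
    N.nodeValue x (N.out j) = N.preactivation x (N.out j) := by
  classical
  have h : ¬ ∃ i, N.inp i = N.out j := fun ⟨i, hi⟩ => N.inp_ne_out i j hi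
  rw [← N.preactivation_eq, nodeValue, WellFounded.fix_eq, dif_neg h, if_pos ⟨j, rfl⟩]
  simp only [dite_eq_ite]

theorem FNN.nodeValue_hidden {m p : ℕ} (N : FNN m p ℝ) (x : Fin m → ℝ) {u : N.V}
    (h : ¬ ∃ i, N.inp i = u) (h' : ¬ ∃ j, N.out j = u) :
    N.nodeValue x u = max 0 (N.preactivation x u) := by
  classical
  rw [← N.preactivation_eq, nodeValue, WellFounded.fix_eq, dif_neg h, if_neg h']
  simp only [dite_eq_ite]

theorem starNet_toFun_one (K : ℕ) : (starNet K).toFun (fun _ => 1) 0 = K + 1 := by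
  classical
  have h0 : (starNet K).nodeValue (fun _ => 1) (0 : Fin (K + 3)) = 1 :=
    (starNet K).nodeValue_inp _ 0
  have hh : ∀ u : Fin (K + 3), u ≠ 0 → u ≠ 1 → (starNet K).nodeValue (fun _ => 1) u = 1 := by
    intro u hu0 hu1
    rw [(starNet K).nodeValue_hidden _ (fun ⟨_, h⟩ => hu0 h.symm) (fun ⟨_, h⟩ => hu1 h.symm)]
    have : (starNet K).preactivation (fun _ => 1) u = 1 := by
      unfold FNN.preactivation
      change (0 : ℝ) + ∑ v : Fin (K + 3), _ = 1
      rw [zero_add, Finset.sum_eq_single (0 : Fin (K + 3))]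
      · rw [h0, mul_one]
        exact if_pos (.inl ⟨rfl, hu0, hu1⟩)
      · intro v _ hv
        have : (starNet K).weight v u = 0 := if_neg (by tauto)
        rw [this, zero_mul]
      · simp
    rw [this]
    simp
  unfold FNN.toFun
  rw [(starNet K).nodeValue_out]
  unfold FNN.preactivation
  change (0 : ℝ) + ∑ v : Fin (K + 3), _ = K + 1
  have : ∀ v : Fin (K + 3), (starNet K).weight v (1 : Fin (K + 3)) *
      (starNet K).nodeValue (fun _ => 1) v = if v ∈ ({0, 1} : Finset (Fin (K + 3)))ᶜ then 1 else 0 := by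
    intro v
    split_ifs with hv
    · simp only [Finset.mem_compl, Finset.mem_insert, Finset.mem_singleton, not_or] at hv
      rw [hh v hv.1 hv.2, mul_one]
      exact if_pos (.inr ⟨hv.1, hv.2, rfl⟩)
    · have : (starNet K).weight v (1 : Fin (K + 3)) = 0 := by
        refine if_neg ?_
        simp only [Finset.mem_compl, Finset.mem_insert, Finset.mem_singleton, not_or] at hv
        tauto
      rw [this, zero_mul]
  rw [zero_add]
  refine (Finset.sum_congr rfl fun v _ => this v).trans ?_
  rw [Finset.sum_boole, Finset.filter_mem_eq_inter, Finset.univ_inter, Finset.card_compl,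
    Finset.card_pair (by simp), Fintype.card_fin]
  push_cast
  norm_num

theorem starNet_rel_input (K : ℕ) (a : Fin 2 → Fin (K + 3)) :
    (starNet K).toStructure.rel .input a ↔ a 0 = 0 ∧ a 1 = 0 :=
  ⟨fun ⟨_, _, _, h⟩ => h, fun h => ⟨0, 0, le_rfl, h⟩⟩

theorem starNet_rel_output (K : ℕ) (a : Fin 2 → Fin (K + 3)) :
    (starNet K).toStructure.rel .output a ↔ a 0 = 1 ∧ a 1 = 1 :=
  ⟨fun ⟨_, _, _, h⟩ => h, fun h => ⟨0, 0, le_rfl, h⟩⟩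

theorem starNet_rel_edge (K : ℕ) (a : Fin 2 → Fin (K + 3)) :
    (starNet K).toStructure.rel .edge a ↔
      (a 0 = 0 ∧ a 1 ≠ 0 ∧ a 1 ≠ 1) ∨ (a 0 ≠ 0 ∧ a 0 ≠ 1 ∧ a 1 = 1) :=
  Iff.rfl

theorem starNet_fn_bias (K : ℕ) (a : Fin 1 → Fin (K + 3)) :
    (starNet K).toStructure.fn .bias a = if a 0 = 0 then ⊥ else ((0 : ℝ) : WithBot ℝ) := by
  classical
  have h : (∃ i, (starNet K).inp i = a 0) ↔ a 0 = 0 := ⟨fun ⟨_, h⟩ => h.symm, fun h => ⟨0, h.symm⟩⟩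
  exact if_congr h rfl rfl

open Classical in
theorem starNet_fn_weight (K : ℕ) (a : Fin 2 → Fin (K + 3)) :
    (starNet K).toStructure.fn .weight a =
      if (starNet K).toStructure.rel .edge a then ((1 : ℝ) : WithBot ℝ) else ⊥ := by
  by_cases h : (starNet K).toStructure.rel .edge a
  · rw [if_pos h]
    refine (if_pos h).trans (congrArg _ ?_)
    exact if_pos h
  · rw [if_neg h]
    exact if_neg h

theorem starNet_symmetricFamily : SymmetricFamily (fun K => (starNet K).toStructure) {0, 1} := by
  classical
  have hrel : ∀ R (b : Fin (netVocab.relArity R) → ℕ), Decided fun K =>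
      (starNet K).toStructure.rel R (nameElem K ∘ b) := by
    intro R b
    have h0 : ∀ i, Decided fun K => nameElem K (b i) = 0 := fun i => decided_nameElem_eq (b i) 0
    have h1 : ∀ i, Decided fun K => nameElem K (b i) = 1 := fun i => decided_nameElem_eq (b i) 1
    cases R with
    | edge =>
      exact (((h0 (0 : Fin 2)).and ((h0 (1 : Fin 2)).not.and (h1 (1 : Fin 2)).not)).or
        ((h0 (0 : Fin 2)).not.and ((h1 (0 : Fin 2)).not.and (h1 (1 : Fin 2))))).of_eventually_iff
        (.of_forall fun K => starNet_rel_edge K (nameElem K ∘ b))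
    | input =>
      exact ((h0 (0 : Fin 2)).and (h0 (1 : Fin 2))).of_eventually_iff
        (.of_forall fun K => starNet_rel_input K (nameElem K ∘ b))
    | output =>
      exact ((h1 (0 : Fin 2)).and (h1 (1 : Fin 2))).of_eventually_iff
        (.of_forall fun K => starNet_rel_output K (nameElem K ∘ b))
  refine ⟨fun K π hπ => ?_, hrel, fun F b => ?_⟩
  · have h0 : ∀ x, π x = 0 ↔ x = 0 := fun x => by
      conv_lhs => rw [← show π 0 = 0 from hπ 0 (by simp)]
      exact π.injective.eq_iff
    have h1 : ∀ x, π x = 1 ↔ x = 1 := fun x => by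
      conv_lhs => rw [← show π 1 = 1 from hπ 1 (by simp)]
      exact π.injective.eq_iff
    have hrel' : ∀ R (a : Fin (netVocab.relArity R) → Fin (K + 3)),
        (starNet K).toStructure.rel R (π ∘ a) ↔ (starNet K).toStructure.rel R a := by
      intro R a
      cases R with
      | edge =>
        refine (starNet_rel_edge K (π ∘ a)).trans (Iff.trans ?_ (starNet_rel_edge K a).symm)
        exact or_congr (and_congr (h0 _) (and_congr (h0 _).not (h1 _).not))
          (and_congr (h0 _).not (and_congr (h1 _).not (h1 _)))
      | input =>
        refine (starNet_rel_input K (π ∘ a)).trans (Iff.trans ?_ (starNet_rel_input K a).symm)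
        exact and_congr (h0 _) (h0 _)
      | output =>
        refine (starNet_rel_output K (π ∘ a)).trans (Iff.trans ?_ (starNet_rel_output K a).symm)
        exact and_congr (h1 _) (h1 _)
    refine ⟨hrel', fun F a => ?_⟩
    cases F with
    | bias =>
      refine (starNet_fn_bias K (π ∘ a)).trans (Eq.trans ?_ (starNet_fn_bias K a).symm)
      exact if_congr (h0 _) rfl rfl
    | weight =>
      refine (starNet_fn_weight K (π ∘ a)).trans (Eq.trans ?_ (starNet_fn_weight K a).symm)
      exact if_congr (hrel' .edge a) rfl rfl
  · cases F with
    | bias =>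
      exact (Tame.ite (decided_nameElem_eq (b (0 : Fin 1)) 0) .bot (.coe 0)).congr
        (.of_forall fun K => starNet_fn_bias K (nameElem K ∘ b))
    | weight =>
      exact (Tame.ite (hrel .edge b) (.coe 1) .bot).congr
        (.of_forall fun K => starNet_fn_weight K (nameElem K ∘ b))

theorem not_expressibleOn_evenAtOne : ¬ evenAtOne.ExpressibleOn FNN.ZeroOneWeights := by
  rintro ⟨φ, hφ⟩
  have hq : ∀ K, evenAtOne (starNet K) ↔ Even (K + 1) := by
    intro K
    unfold evenAtOne
    rw [starNet_toFun_one]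
    constructor
    · rintro ⟨k, hk, h⟩
      have : K + 1 = k := by exact_mod_cast h
      rwa [this]
    · exact fun h => ⟨K + 1, h, by push_cast; rfl⟩
  have key : ∀ K, (starNet K).toStructure.Models φ ↔ Even (K + 1) := fun K =>
    (hφ _ (starNet_zeroOneWeights K)).trans (hq K)
  rcases starNet_symmetricFamily.decided_models φ with h | h
  · obtain ⟨K, hK⟩ := eventually_atTop.1 h
    have h1 := (key _).1 (hK K le_rfl)
    have h2 := (key _).1 (hK (K + 1) (by omega))
    exact (Nat.even_add_one.1 h2) h1
  · obtain ⟨K, hK⟩ := eventually_atTop.1 h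
    have h1 := mt (key _).2 (hK K le_rfl)
    exact mt (key _).2 (hK (K + 1) (by omega)) (Nat.even_add_one.2 h1)

end StarNetworks

section RamLogic

/-- Every subexpression has a value of absolute value below `H`. -/
def RamExpr.AllSmall (H : ℤ) (s : RamState) : RamExpr → Prop
  | .lit z => |z| < H
  | .var i => |s.var i| < H
  | .cell a e => e.AllSmall H s ∧ |s.cell a (e.eval s)| < H
  | .add e₁ e₂ => e₁.AllSmall H s ∧ e₂.AllSmall H s ∧ |e₁.eval s + e₂.eval s| < H
  | .sub e₁ e₂ => e₁.AllSmall H s ∧ e₂.AllSmall H s ∧ |e₁.eval s - e₂.eval s| < H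
  | .mul e₁ e₂ => e₁.AllSmall H s ∧ e₂.AllSmall H s ∧ |e₁.eval s * e₂.eval s| < H
  | .div e₁ e₂ => e₁.AllSmall H s ∧ e₂.AllSmall H s ∧ |e₁.eval s / e₂.eval s| < H

/-- The number of subexpressions. -/
def RamExpr.size : RamExpr → ℕ
  | .lit _ => 1
  | .var _ => 1
  | .cell _ e => e.size + 1
  | .add e₁ e₂ => e₁.size + e₂.size + 1
  | .sub e₁ e₂ => e₁.size + e₂.size + 1
  | .mul e₁ e₂ => e₁.size + e₂.size + 1
  | .div e₁ e₂ => e₁.size + e₂.size + 1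

theorem bitLength_le {z : ℤ} {k : ℕ} (h : |z| < 2 ^ k) : bitLength z ≤ k + 1 := by
  have : z.natAbs < 2 ^ k := by
    zify
    exact h
  exact Nat.succ_le_succ (Nat.size_le.2 this)

theorem RamExpr.cost_le {k : ℕ} {s : RamState} (e : RamExpr) (h : e.AllSmall (2 ^ k) s) :
    e.cost s ≤ e.size * (k + 1) := by
  induction e with
  | lit z => simpa [size, cost] using bitLength_le h
  | var i => simpa [size, cost] using bitLength_le h
  | cell a e ih =>
    have h2 := bitLength_le h.2
    have h1 := ih h.1
    simp only [size, cost, eval]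
    linarith
  | add e₁ e₂ ih₁ ih₂ | sub e₁ e₂ ih₁ ih₂ | mul e₁ e₂ ih₁ ih₂ | div e₁ e₂ ih₁ ih₂ =>
    have h3 := bitLength_le h.2.2
    have h1 := ih₁ h.1
    have h2 := ih₂ h.2.1
    simp only [size, cost, eval]
    linarith

/-- The program `c`, started in `s`, halts at cost at most `T` in a state satisfying `Q`. -/
def RamWp (c : RamProg) (s : RamState) (T : ℕ) (Q : RamState → Prop) : Prop :=
  ∃ t s', RamRuns c s t s' ∧ t ≤ T ∧ Q s'

theorem RamWp.mono {c : RamProg} {s : RamState} {T T' : ℕ} {Q Q' : RamState → Prop}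
    (h : RamWp c s T Q) (hT : T ≤ T') (hQ : ∀ s, Q s → Q' s) : RamWp c s T' Q' := by
  obtain ⟨t, s', h1, h2, h3⟩ := h
  exact ⟨t, s', h1, h2.trans hT, hQ _ h3⟩

theorem RamWp.skip {s : RamState} {T : ℕ} {Q : RamState → Prop} (h : Q s) :
    RamWp .skip s (T + 1) Q :=
  ⟨_, _, .skip s, by omega, h⟩

/-- The state after assigning to a variable. -/
def RamState.setVar (s : RamState) (i : ℕ) (z : ℤ) : RamState :=
  { s with var := Function.update s.var i z }

/-- The state after writing to an array. -/
def RamState.setCell (s : RamState) (a : ℕ) (k z : ℤ) : RamState :=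
  { s with cell := Function.update s.cell a (Function.update (s.cell a) k z) }

@[simp] theorem RamState.setVar_var (s : RamState) (i j : ℕ) (z : ℤ) :
    (s.setVar i z).var j = if j = i then z else s.var j := by
  simp [setVar, Function.update_apply]

@[simp] theorem RamState.setVar_cell (s : RamState) (i : ℕ) (z : ℤ) :
    (s.setVar i z).cell = s.cell := rfl

@[simp] theorem RamState.setCell_var (s : RamState) (a : ℕ) (k z : ℤ) :
    (s.setCell a k z).var = s.var := rfl

theorem RamState.setCell_cell_same (s : RamState) (a : ℕ) (k z j : ℤ) :
    (s.setCell a k z).cell a j = if j = k then z else s.cell a j := by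
  simp [setCell, Function.update_apply]

theorem RamState.setCell_cell_ne (s : RamState) {a b : ℕ} (h : b ≠ a) (k z : ℤ) :
    (s.setCell a k z).cell b = s.cell b := by
  simp [setCell, h]

theorem RamWp.assign {i : ℕ} {e : RamExpr} {s : RamState} {k T : ℕ} {Q : RamState → Prop}
    (he : e.AllSmall (2 ^ k) s) (hT : e.size * (k + 1) + 1 ≤ T) (h : Q (s.setVar i (e.eval s))) :
    RamWp (.assign i e) s T Q :=
  ⟨_, _, .assign i e s, by have := e.cost_le he; omega, h⟩

theorem RamWp.store {a : ℕ} {e₁ e₂ : RamExpr} {s : RamState} {k T : ℕ} {Q : RamState → Prop}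
    (h₁ : e₁.AllSmall (2 ^ k) s) (h₂ : e₂.AllSmall (2 ^ k) s)
    (hT : e₁.size * (k + 1) + e₂.size * (k + 1) + 1 ≤ T)
    (h : Q (s.setCell a (e₁.eval s) (e₂.eval s))) : RamWp (.store a e₁ e₂) s T Q :=
  ⟨_, _, .store a e₁ e₂ s, by have := e₁.cost_le h₁; have := e₂.cost_le h₂; omega, h⟩

theorem RamWp.seq {c₁ c₂ : RamProg} {s : RamState} {T₁ T₂ T : ℕ} {Q : RamState → Prop}
    (h : RamWp c₁ s T₁ fun s₁ => RamWp c₂ s₁ T₂ Q) (hT : T₁ + T₂ + 1 ≤ T) :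
    RamWp (.seq c₁ c₂) s T Q := by
  obtain ⟨t₁, s₁, h1, h2, t₂, s₂, h3, h4, h5⟩ := h
  exact ⟨_, _, .seq h1 h3, by omega, h5⟩

theorem RamWp.cond {e : RamExpr} {c₁ c₂ : RamProg} {s : RamState} {k T T' : ℕ}
    {Q : RamState → Prop} (he : e.AllSmall (2 ^ k) s) (hT : e.size * (k + 1) + T + 1 ≤ T')
    (h₁ : 0 < e.eval s → RamWp c₁ s T Q) (h₂ : ¬ 0 < e.eval s → RamWp c₂ s T Q) :
    RamWp (.cond e c₁ c₂) s T' Q := by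
  have hc := e.cost_le he
  by_cases h : 0 < e.eval s
  · obtain ⟨t, s', h1, h2, h3⟩ := h₁ h
    exact ⟨_, _, .cond_pos h h1, by omega, h3⟩
  · obtain ⟨t, s', h1, h2, h3⟩ := h₂ h
    exact ⟨_, _, .cond_neg h h1, by omega, h3⟩

/-- The rule for a loop with `N` rounds and the invariant `I`. -/
theorem RamWp.loop {e : RamExpr} {c : RamProg} {k T N : ℕ} (I : ℕ → RamState → Prop)
    (hsmall : ∀ j s, j ≤ N → I j s → e.AllSmall (2 ^ k) s)
    (heval : ∀ j s, j ≤ N → I j s → e.eval s = N - j)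
    (hstep : ∀ j s, j < N → I j s → RamWp c s T (I (j + 1))) {s : RamState} (h : I 0 s) :
    RamWp (.loop e c) s ((N + 1) * (e.size * (k + 1) + T + 1)) (I N) := by
  suffices H : ∀ m j s, j + m = N → I j s →
      RamWp (.loop e c) s ((m + 1) * (e.size * (k + 1) + T + 1)) (I N) from H N 0 s (by omega) h
  intro m
  induction m with
  | zero =>
    intro j s hj hs
    obtain rfl : j = N := by omega
    have hc := e.cost_le (hsmall j s le_rfl hs)
    exact ⟨_, _, .loop_done (by rw [heval j s le_rfl hs]; simp), by omega, hs⟩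
  | succ m ih =>
    intro j s hj hs
    have hc := e.cost_le (hsmall j s (by omega) hs)
    obtain ⟨t, s', h1, h2, h3⟩ := hstep j s (by omega) hs
    obtain ⟨t', s'', h4, h5, h6⟩ := ih (j + 1) s' (by omega) h3
    refine ⟨_, _, .loop_step ?_ h1 h4, ?_, h6⟩
    · rw [heval j s (by omega) hs]
      omega
    · have : (m + 1 + 1) * (e.size * (k + 1) + T + 1) =
          (m + 1) * (e.size * (k + 1) + T + 1) + (e.size * (k + 1) + T + 1) := by ring
      omega

end RamLogic

section Layers

/-- The bias of node `u`, multiplied by the common denominator `D`. -/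
def scaledBias (a : ℤ → ℤ) (D : ℤ) (u : ℕ) : ℤ :=
  a (3 + 2 * u) * (D / a (4 + 2 * u))

/-- The weight of the pair `(v, u)`, multiplied by the common denominator `D`. -/
def scaledWeight (a : ℤ → ℤ) (D : ℤ) (n v u : ℕ) : ℤ :=
  a (3 + 2 * n + 3 * (v * n + u) + 1) * (D / a (3 + 2 * n + 3 * (v * n + u) + 2))

/-- The values of the nodes after `t` rounds of simultaneous evaluation, multiplied by `D ^ t`. -/
def layerValue (a : ℤ → ℤ) (D : ℤ) (n : ℕ) : ℕ → ℕ → ℤ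
  | 0, _ => 0
  | t + 1, u =>
    if (u : ℤ) = a 1 then D * D ^ t
    else if (u : ℤ) = a 2 then
      scaledBias a D u * D ^ t + ∑ v ∈ Finset.range n, scaledWeight a D n v u * layerValue a D n t v
    else max 0 (scaledBias a D u * D ^ t +
      ∑ v ∈ Finset.range n, scaledWeight a D n v u * layerValue a D n t v)

/-- The bounds on the input array `a`, on the number `n` of nodes and on the common denominator `D`
in terms of the size `S` of the input. -/
structure NetArray (a : ℤ → ℤ) (D : ℤ) (n S : ℕ) : Prop where
  size_eq : a 0 = n
  inp_nonneg : 0 ≤ a 1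
  inp_lt : a 1 < n
  out_nonneg : 0 ≤ a 2
  out_lt : a 2 < n
  small : ∀ k, |a k| ≤ 2 ^ S
  denom_pos : 0 < D
  denom_le : D ≤ 2 ^ S
  size_le : 3 * (n * n) + 2 * n + 3 ≤ S

namespace NetArray

variable {a : ℤ → ℤ} {D : ℤ} {n S : ℕ}

theorem abs_denom_div_le (h : NetArray a D n S) (z : ℤ) : |D / z| ≤ 2 ^ S :=
  (Int.abs_ediv_le_abs D z).trans (by rw [abs_of_pos h.denom_pos]; exact h.denom_le)

theorem abs_entry_mul_div_le (h : NetArray a D n S) (i z : ℤ) : |a i * (D / z)| ≤ 2 ^ (2 * S) := by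
  rw [abs_mul, two_mul, pow_add]
  exact mul_le_mul (h.small i) (h.abs_denom_div_le z) (abs_nonneg _) (by positivity)

theorem denom_pow_le (h : NetArray a D n S) (t : ℕ) : D ^ t ≤ 2 ^ (3 * S * t) :=
  calc D ^ t ≤ (2 ^ S) ^ t := pow_le_pow_left₀ h.denom_pos.le h.denom_le t
    _ = 2 ^ (S * t) := by rw [pow_mul]
    _ ≤ 2 ^ (3 * S * t) := pow_le_pow_right₀ (by norm_num) (by nlinarith [Nat.zero_le (S * t)])

theorem abs_bias_term_le (h : NetArray a D n S) (t : ℕ) (i z : ℤ) :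
    |a i * (D / z) * D ^ t| ≤ 2 ^ (2 * S + 3 * S * t) := by
  rw [abs_mul, abs_of_pos (pow_pos h.denom_pos t), pow_add]
  exact mul_le_mul (h.abs_entry_mul_div_le i z) (h.denom_pow_le t) (pow_pos h.denom_pos t).le
    (by positivity)

theorem succ_le_two_pow (h : NetArray a D n S) : (n : ℤ) + 1 ≤ 2 ^ S := by
  have h1 := h.size_le
  have h2 : S < 2 ^ S := Nat.lt_two_pow_self
  have : n + 1 ≤ 2 ^ S := by nlinarith
  exact_mod_cast this

theorem abs_weight_term_le (h : NetArray a D n S) {t : ℕ} {p : ℤ} (hp : |p| ≤ 2 ^ (3 * S * t))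
    (i z : ℤ) : |a i * (D / z) * p| ≤ 2 ^ (2 * S + 3 * S * t) := by
  rw [abs_mul, pow_add]
  exact mul_le_mul (h.abs_entry_mul_div_le i z) hp (abs_nonneg _) (by positivity)

theorem abs_partial_sum_le (h : NetArray a D n S) {t : ℕ} {p : ℕ → ℤ}
    (hp : ∀ v, |p v| ≤ 2 ^ (3 * S * t)) (u : ℕ) {m : ℕ} (hm : m ≤ n) :
    |scaledBias a D u * D ^ t + ∑ v ∈ Finset.range m, scaledWeight a D n v u * p v| ≤
      2 ^ (3 * S * (t + 1)) :=
  calc |scaledBias a D u * D ^ t + ∑ v ∈ Finset.range m, scaledWeight a D n v u * p v|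
      ≤ |scaledBias a D u * D ^ t| + |∑ v ∈ Finset.range m, scaledWeight a D n v u * p v| :=
        abs_add_le _ _
    _ ≤ 2 ^ (2 * S + 3 * S * t) + ∑ v ∈ Finset.range m, 2 ^ (2 * S + 3 * S * t) :=
        add_le_add (h.abs_bias_term_le t _ _) ((Finset.abs_sum_le_sum_abs _ _).trans
          (Finset.sum_le_sum fun v _ => h.abs_weight_term_le (hp v) _ _))
    _ = (m + 1) * 2 ^ (2 * S + 3 * S * t) := by simp; ring
    _ ≤ 2 ^ S * 2 ^ (2 * S + 3 * S * t) := by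
        refine mul_le_mul_of_nonneg_right (le_trans ?_ h.succ_le_two_pow) (by positivity)
        exact_mod_cast Nat.succ_le_succ hm
    _ = 2 ^ (3 * S * (t + 1)) := by rw [← pow_add]; congr 1; ring

theorem abs_layerValue_le (h : NetArray a D n S) (t u : ℕ) :
    |layerValue a D n t u| ≤ 2 ^ (3 * S * t) := by
  induction t generalizing u with
  | zero => simp [layerValue]
  | succ t ih =>
    have hs := h.abs_partial_sum_le ih u le_rfl
    unfold layerValue
    split_ifs
    · rw [← pow_succ', abs_of_pos (pow_pos h.denom_pos _)]
      exact h.denom_pow_le _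
    · exact hs
    · rw [abs_of_nonneg (le_max_left _ _)]
      exact max_le (by positivity) ((le_abs_self _).trans hs)

end NetArray

end Layers

section Program

/-- `cell 0 e`, the entry of the input at position `e`. -/
abbrev RamExpr.entry (e : RamExpr) : RamExpr := .cell 0 e

/-- The number of nodes of the network. -/
abbrev RamExpr.order : RamExpr := .entry (.lit 0)

/-- The expression `1 - (e₁ - e₂)²`, which is positive iff `e₁ = e₂`. -/
abbrev RamExpr.eqTest (e₁ e₂ : RamExpr) : RamExpr :=
  .sub (.lit 1) (.mul (.sub e₁ e₂) (.sub e₁ e₂))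

/-- Multiply up the positive entries of the input in variable `1`. -/
def denomProg : RamProg :=
  .seq (.assign 1 (.lit 1))
    (.loop (.sub (.var 0) (.var 7))
      (.seq (.cond (.entry (.var 7)) (.assign 1 (.mul (.var 1) (.entry (.var 7)))) .skip)
        (.assign 7 (.add (.var 7) (.lit 1)))))

/-- The position of the edge from node `var 5` to node `var 4` in the input. -/
abbrev RamExpr.edgePos : RamExpr :=
  .add (.add (.lit 3) (.mul (.lit 2) .order))
    (.mul (.lit 3) (.add (.mul (.var 5) .order) (.var 4)))

/-- Add the contribution of all predecessors of node `var 4` to variable `6`. -/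
def sumProg : RamProg :=
  .loop (.sub .order (.var 5))
    (.seq (.assign 6 (.add (.var 6)
        (.mul (.mul (.entry (.add .edgePos (.lit 1)))
            (.div (.var 1) (.entry (.add .edgePos (.lit 2)))))
          (.cell 1 (.add (.mul (.var 3) .order) (.var 5))))))
      (.assign 5 (.add (.var 5) (.lit 1))))

/-- Apply the activation function of node `var 4` to variable `6`. -/
def activationProg : RamProg :=
  .cond (.eqTest (.var 4) (.entry (.lit 1))) (.assign 6 (.mul (.var 1) (.var 2)))
    (.cond (.eqTest (.var 4) (.entry (.lit 2))) .skip
      (.cond (.var 6) .skip (.assign 6 (.lit 0))))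

/-- Compute the next value of node `var 4`. -/
def nodeProg : RamProg :=
  .seq (.assign 6 (.mul (.mul (.entry (.add (.lit 3) (.mul (.lit 2) (.var 4))))
      (.div (.var 1) (.entry (.add (.lit 4) (.mul (.lit 2) (.var 4)))))) (.var 2)))
    (.seq (.assign 5 (.lit 0))
      (.seq sumProg
        (.seq activationProg
          (.seq (.store 1 (.add (.mul (.add (.var 3) (.lit 1)) .order) (.var 4)) (.var 6))
            (.assign 4 (.add (.var 4) (.lit 1)))))))

/-- Compute the next values of all nodes. -/
def roundProg : RamProg :=
  .seq (.assign 4 (.lit 0))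
    (.seq (.loop (.sub .order (.var 4)) nodeProg)
      (.seq (.assign 2 (.mul (.var 2) (.var 1))) (.assign 3 (.add (.var 3) (.lit 1)))))

/-- Test whether `var 6 / var 2` is an even natural number. -/
def parityProg : RamProg :=
  .cond (.add (.var 6) (.lit 1))
    (.cond (.sub (.lit 1) (.sub (.var 6)
        (.mul (.mul (.lit 2) (.var 2)) (.div (.var 6) (.mul (.lit 2) (.var 2))))))
      (.assign 0 (.lit 1)) (.assign 0 (.lit 0)))
    (.assign 0 (.lit 0))

/-- Decide whether the network in the input maps `1` to an even natural number. -/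
def evenAtOneProg : RamProg :=
  .seq denomProg
    (.seq (.assign 2 (.lit 1))
      (.seq (.loop (.sub .order (.var 3)) roundProg)
        (.seq (.assign 6 (.cell 1 (.add (.mul .order .order) (.entry (.lit 2))))) parityProg)))

/-- The exponent of a bound on all numbers occurring in the computation. -/
def workBits (S : ℕ) : ℕ := 3 * S * S + 10

/-- The state before the value of node `u` in round `t + 1` is computed. -/
structure NodeState (a : ℤ → ℤ) (D : ℤ) (n t u : ℕ) (s : RamState) : Prop where
  input : s.cell 0 = a
  var_one : s.var 1 = D
  var_two : s.var 2 = D ^ t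
  var_three : s.var 3 = t
  var_four : s.var 4 = u
  current : ∀ v : ℕ, v < n → s.cell 1 (t * n + v) = layerValue a D n t v
  next : ∀ v : ℕ, v < u → s.cell 1 ((t + 1) * n + v) = layerValue a D n (t + 1) v

theorem NodeState.setVar {a : ℤ → ℤ} {D : ℤ} {n t u : ℕ} {s : RamState}
    (h : NodeState a D n t u s) {i : ℕ} (hi : 5 ≤ i) (z : ℤ) :
    NodeState a D n t u (s.setVar i z) where
  input := h.input
  var_one := by simpa [show 1 ≠ i by omega] using h.var_one
  var_two := by simpa [show 2 ≠ i by omega] using h.var_two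
  var_three := by simpa [show 3 ≠ i by omega] using h.var_three
  var_four := by simpa [show 4 ≠ i by omega] using h.var_four
  current := h.current
  next := h.next

namespace NetArray

variable {a : ℤ → ℤ} {D : ℤ} {n S : ℕ}

theorem pow_mul_le_bound {t : ℕ} (ht : t ≤ S) : (2 : ℤ) ^ (3 * S * t) * 1024 ≤ 2 ^ workBits S := by
  have : (1024 : ℤ) = 2 ^ 10 := by norm_num
  rw [this, ← pow_add]
  refine pow_le_pow_right₀ (by norm_num) ?_
  unfold workBits
  nlinarith

theorem two_pow_le (h : NetArray a D n S) : (2 : ℤ) ^ (2 * S) * 1024 ≤ 2 ^ workBits S := by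
  have : (1024 : ℤ) = 2 ^ 10 := by norm_num
  have := h.size_le
  rw [‹(1024 : ℤ) = 2 ^ 10›, ← pow_add]
  refine pow_le_pow_right₀ (by norm_num) ?_
  unfold workBits
  nlinarith

theorem order_le (h : NetArray a D n S) : n ≤ S := by
  have := h.size_le
  nlinarith

theorem square_le (h : NetArray a D n S) : 3 * ((n : ℤ) * n) + 2 * n + 3 ≤ 2 ^ S := by
  have h1 := h.size_le
  have h2 : S < 2 ^ S := Nat.lt_two_pow_self
  have : 3 * (n * n) + 2 * n + 3 ≤ 2 ^ S := by omega
  exact_mod_cast this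

theorem pow_size_mul_le (h : NetArray a D n S) : (2 : ℤ) ^ S * 1024 ≤ 2 ^ workBits S := by
  refine le_trans ?_ h.two_pow_le
  have : (2 : ℤ) ^ S ≤ 2 ^ (2 * S) := pow_le_pow_right₀ (by norm_num) (by omega)
  linarith

theorem three_le_two_pow (h : NetArray a D n S) : (3 : ℤ) ≤ 2 ^ S := by
  have h1 : (0 : ℤ) ≤ n * n := by positivity
  have h2 : (0 : ℤ) ≤ n := by positivity
  linarith [h.square_le]

theorem abs_entry_lt (h : NetArray a D n S) (z : ℤ) : |a z| < 2 ^ workBits S :=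
  (h.small z).trans_lt (by linarith [h.pow_size_mul_le, h.three_le_two_pow])

theorem abs_denom_div_lt (h : NetArray a D n S) (z : ℤ) : |D / z| < 2 ^ workBits S :=
  (h.abs_denom_div_le z).trans_lt (by linarith [h.pow_size_mul_le, h.three_le_two_pow])

theorem abs_denom_lt (h : NetArray a D n S) : |D| < 2 ^ workBits S := by
  rw [abs_of_pos h.denom_pos]
  linarith [h.pow_size_mul_le, h.three_le_two_pow, h.denom_le]

theorem abs_entry_mul_div_lt (h : NetArray a D n S) (z w : ℤ) :
    |a z * (D / w)| < 2 ^ workBits S := by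
  refine (h.abs_entry_mul_div_le z w).trans_lt ?_
  have : (0 : ℤ) < 2 ^ (2 * S) := by positivity
  linarith [h.two_pow_le]

theorem abs_lt_bound (h : NetArray a D n S) {t : ℕ} (ht : t ≤ n) {x : ℤ}
    (hx : |x| ≤ 2 ^ (3 * S * t)) : |x| < 2 ^ workBits S := by
  have h1 := pow_mul_le_bound (ht.trans h.order_le)
  have h2 : (1 : ℤ) ≤ 2 ^ (3 * S * t) := one_le_pow₀ (by norm_num)
  linarith

theorem index_lt (h : NetArray a D n S) : 1000 * (n : ℤ) * n + 1000 * n + 1000 < 2 ^ workBits S := by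
  have h1 : (0 : ℤ) ≤ n * n := by positivity
  have h2 : (0 : ℤ) ≤ n := by positivity
  linarith [h.pow_size_mul_le, h.square_le]

theorem mul_add_lt {v u : ℕ} (hv : v < n) (hu : u < n) : (v : ℤ) * n + u < n * n := by
  have : v * n + u < n * n := by nlinarith
  exact_mod_cast this

set_option maxHeartbeats 1000000 in
theorem allSmall_sum (h : NetArray a D n S) {t u v : ℕ} (ht : t < n) (hu : u < n) (hv : v < n)
    {s : RamState} (hs : NodeState a D n t u s) (h5 : s.var 5 = v)
    (h6 : s.var 6 = scaledBias a D u * D ^ t +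
      ∑ v ∈ Finset.range v, scaledWeight a D n v u * layerValue a D n t v) :
    RamExpr.AllSmall (2 ^ workBits S) s (.add (.var 6)
        (.mul (.mul (.entry (.add .edgePos (.lit 1)))
            (.div (.var 1) (.entry (.add .edgePos (.lit 2)))))
          (.cell 1 (.add (.mul (.var 3) .order) (.var 5))))) := by
  have hsum := fun {m} (hm : m ≤ n) => h.abs_lt_bound (Nat.succ_le_of_lt ht)
    (h.abs_partial_sum_le (h.abs_layerValue_le t) u hm)
  have hacc := hsum hv.le
  have hacc' := hsum (Nat.succ_le_of_lt hv)
  rw [Nat.succ_eq_add_one, Finset.sum_range_succ, ← add_assoc] at hacc'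
  have hterm : |scaledWeight a D n v u * layerValue a D n t v| < 2 ^ workBits S :=
    h.abs_lt_bound (Nat.succ_le_of_lt ht) ((h.abs_weight_term_le (h.abs_layerValue_le t v) _ _).trans
      (pow_le_pow_right₀ (by norm_num) (by rw [Nat.succ_eq_add_one]; nlinarith)))
  have hP := h.abs_lt_bound ht.le (h.abs_layerValue_le t v)
  have hvu := mul_add_lt hv hu
  have htv := mul_add_lt ht hv
  have hvn : (0 : ℤ) ≤ v * n := by positivity
  have htn : (0 : ℤ) ≤ t * n := by positivity
  have hv' : (v : ℤ) < n := by exact_mod_cast hv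
  have ht' : (t : ℤ) < n := by exact_mod_cast ht
  have hu0 : (0 : ℤ) ≤ u := Int.natCast_nonneg u
  have hv0 : (0 : ℤ) ≤ v := Int.natCast_nonneg v
  have ht0 : (0 : ℤ) ≤ t := Int.natCast_nonneg t
  have hw : |scaledWeight a D n v u| < 2 ^ workBits S := h.abs_entry_mul_div_lt _ _
  have hent := h.abs_entry_lt
  have hdiv := h.abs_denom_div_lt
  have hD := h.abs_denom_lt
  have hH := h.index_lt
  simp only [RamExpr.AllSmall, RamExpr.eval, hs.input, hs.var_one, hs.var_three, hs.var_four, h5, h6,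
    h.size_eq, hs.current v hv]
  rw [← scaledWeight]
  generalize (2 : ℤ) ^ workBits S = H at *
  repeat' apply And.intro
  all_goals first
    | with_reducible exact hent _
    | with_reducible exact hdiv _
    | with_reducible assumption
    | refine abs_lt.2 ⟨?_, ?_⟩ <;>
        linarith only [hvu, htv, hvn, htn, hv', ht', hH, hu0, hv0, ht0]

theorem allSmall_bias (h : NetArray a D n S) {t u : ℕ} (ht : t < n) (hu : u < n)
    {s : RamState} (hs : NodeState a D n t u s) :
    RamExpr.AllSmall (2 ^ workBits S) s (.mul (.mul (.entry (.add (.lit 3) (.mul (.lit 2) (.var 4))))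
      (.div (.var 1) (.entry (.add (.lit 4) (.mul (.lit 2) (.var 4)))))) (.var 2)) := by
  have hu' : (u : ℤ) < n := by exact_mod_cast hu
  have hu0 : (0 : ℤ) ≤ u := Int.natCast_nonneg u
  have hnn : (0 : ℤ) ≤ n * n := by positivity
  have hent := h.abs_entry_lt
  have hdiv := h.abs_denom_div_lt
  have hmul := h.abs_entry_mul_div_lt
  have hD := h.abs_denom_lt
  have hH := h.index_lt
  have hDt : |D ^ t| < 2 ^ workBits S := h.abs_lt_bound ht.le (by
    rw [abs_of_pos (pow_pos h.denom_pos t)]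
    exact h.denom_pow_le t)
  have hterm : ∀ i z, |a i * (D / z) * D ^ t| < 2 ^ workBits S := fun i z =>
    h.abs_lt_bound (Nat.succ_le_of_lt ht) ((h.abs_bias_term_le t i z).trans
      (pow_le_pow_right₀ (by norm_num) (by rw [Nat.succ_eq_add_one]; nlinarith)))
  simp only [RamExpr.AllSmall, RamExpr.eval, hs.input, hs.var_one, hs.var_two, hs.var_four]
  generalize (2 : ℤ) ^ workBits S = H at *
  repeat' apply And.intro
  all_goals first
    | with_reducible exact hent _
    | with_reducible exact hdiv _
    | with_reducible exact hmul _ _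
    | with_reducible exact hterm _ _
    | with_reducible assumption
    | refine abs_lt.2 ⟨?_, ?_⟩ <;> linarith only [hu', hH, hu0, hnn]

theorem allSmall_order_sub (h : NetArray a D n S) {s : RamState} (hs : s.cell 0 = a) {i j : ℕ}
    (hi : s.var i = j) (hj : j ≤ n) : RamExpr.AllSmall (2 ^ workBits S) s (.sub .order (.var i)) := by
  have hj' : (j : ℤ) ≤ n := by exact_mod_cast hj
  have hj0 : (0 : ℤ) ≤ j := Int.natCast_nonneg j
  have hnn : (0 : ℤ) ≤ n * n := by positivity
  have hH := h.index_lt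
  simp only [RamExpr.AllSmall, RamExpr.eval, hs, hi, h.size_eq]
  refine ⟨⟨?_, ?_⟩, ?_, ?_⟩ <;> refine abs_lt.2 ⟨?_, ?_⟩ <;> linarith

theorem eval_order_sub (h : NetArray a D n S) {s : RamState} (hs : s.cell 0 = a) {i j : ℕ}
    (hi : s.var i = j) : RamExpr.eval s (.sub .order (.var i)) = n - j := by
  simp only [RamExpr.eval, hs, hi, h.size_eq]

theorem allSmall_succ (h : NetArray a D n S) {s : RamState} {i j : ℕ}
    (hi : s.var i = j) (hj : j ≤ n) :
    RamExpr.AllSmall (2 ^ workBits S) s (.add (.var i) (.lit 1)) := by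
  have hj' : (j : ℤ) ≤ n := by exact_mod_cast hj
  have hj0 : (0 : ℤ) ≤ j := Int.natCast_nonneg j
  have hnn : (0 : ℤ) ≤ n * n := by positivity
  have hH := h.index_lt
  simp only [RamExpr.AllSmall, RamExpr.eval, hi]
  refine ⟨?_, ?_, ?_⟩ <;> refine abs_lt.2 ⟨?_, ?_⟩ <;> linarith

theorem allSmall_lit (S : ℕ) (s : RamState) {z : ℤ} (hz : |z| ≤ 2) :
    RamExpr.AllSmall (2 ^ workBits S) s (.lit z) := by
  have : (2 : ℤ) ^ 10 ≤ 2 ^ workBits S :=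
    pow_le_pow_right₀ (by norm_num) (by unfold workBits; omega)
  exact hz.trans_lt (by norm_num at this; linarith)

theorem allSmall_eqTest (h : NetArray a D n S) {s : RamState} (hs : s.cell 0 = a) {i u : ℕ}
    (hi : s.var i = u) (hu : u < n) {z : ℤ} (hz : |z| ≤ 2) (haz : 0 ≤ a z) (haz' : a z < n) :
    RamExpr.AllSmall (2 ^ workBits S) s (.eqTest (.var i) (.entry (.lit z))) := by
  have hu' : (u : ℤ) < n := by exact_mod_cast hu
  have hu0 : (0 : ℤ) ≤ u := Int.natCast_nonneg u
  have hnn : (0 : ℤ) ≤ n * n := by positivity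
  have hlit : |z| < 2 ^ workBits S := allSmall_lit S s hz
  have h1 : |(1 : ℤ)| < 2 ^ workBits S := allSmall_lit S s (by norm_num)
  have hent := h.abs_entry_lt z
  have hH := h.index_lt
  have hsq : ((u : ℤ) - a z) * (u - a z) ≤ n * n := by nlinarith
  have hsq0 : 0 ≤ ((u : ℤ) - a z) * (u - a z) := mul_self_nonneg _
  simp only [RamExpr.AllSmall, RamExpr.eval, hs, hi]
  generalize (2 : ℤ) ^ workBits S = H at *
  repeat' apply And.intro
  all_goals first
    | with_reducible assumption
    | refine abs_lt.2 ⟨?_, ?_⟩ <;> linarith only [hu', hu0, hnn, hH, hsq, hsq0, haz, haz']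

theorem eval_eqTest_pos {s : RamState} {e₁ e₂ : RamExpr} :
    0 < (RamExpr.eqTest e₁ e₂).eval s ↔ e₁.eval s = e₂.eval s := by
  simp only [RamExpr.eval]
  constructor
  · intro h
    by_contra hne
    have : 0 < (e₁.eval s - e₂.eval s) * (e₁.eval s - e₂.eval s) :=
      mul_self_pos.2 (sub_ne_zero.2 hne)
    linarith
  · intro h
    simp [h]

theorem sumProg_wp (h : NetArray a D n S) {t u : ℕ} (ht : t < n) (hu : u < n) {s : RamState}
    (hs : NodeState a D n t u s) (h5 : s.var 5 = 0) (h6 : s.var 6 = scaledBias a D u * D ^ t) :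
    RamWp sumProg s ((n + 1) * (100 * (workBits S + 1))) fun s' =>
      NodeState a D n t u s' ∧ s'.var 6 = scaledBias a D u * D ^ t +
        ∑ v ∈ Finset.range n, scaledWeight a D n v u * layerValue a D n t v := by
  refine (RamWp.loop (k := workBits S) (T := 90 * (workBits S + 1)) (fun v s =>
    NodeState a D n t u s ∧ s.var 5 = v ∧ s.var 6 = scaledBias a D u * D ^ t +
      ∑ v ∈ Finset.range v, scaledWeight a D n v u * layerValue a D n t v)
    (fun v s hv hs => h.allSmall_order_sub hs.1.input hs.2.1 hv)
    (fun v s hv hs => h.eval_order_sub hs.1.input hs.2.1) ?_ ⟨hs, by simpa using h5, by simpa using h6⟩).mono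
    (Nat.mul_le_mul_left _ (by simp only [RamExpr.size]; omega)) fun s hs => ⟨hs.1, hs.2.2⟩
  rintro v s hv ⟨hs, h5, h6⟩
  refine RamWp.seq (T₁ := 60 * (workBits S + 1)) (T₂ := 10 * (workBits S + 1))
    (RamWp.assign (h.allSmall_sum ht hu hv hs h5 h6) (by simp only [RamExpr.size]; omega) ?_) (by omega)
  refine RamWp.assign (h.allSmall_succ (j := v) (by simpa using h5) hv.le)
    (by simp only [RamExpr.size]; omega) ⟨(hs.setVar (by norm_num) _).setVar (by norm_num) _, ?_, ?_⟩
  · simp [RamExpr.eval, h5]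
  · rw [Finset.sum_range_succ, ← add_assoc, ← h6]
    simp [RamExpr.eval, hs.input, hs.var_one, hs.var_three, hs.var_four, h5, h.size_eq,
      hs.current v hv, scaledWeight]

theorem activationProg_wp (h : NetArray a D n S) {t u : ℕ} (ht : t < n) (hu : u < n) {s : RamState}
    (hs : NodeState a D n t u s) (h6 : s.var 6 = scaledBias a D u * D ^ t +
        ∑ v ∈ Finset.range n, scaledWeight a D n v u * layerValue a D n t v) :
    RamWp activationProg s (50 * (workBits S + 1)) fun s' =>
      NodeState a D n t u s' ∧ s'.var 6 = layerValue a D n (t + 1) u := by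
  have h6' : |s.var 6| < 2 ^ workBits S := by
    rw [h6]
    exact h.abs_lt_bound (Nat.succ_le_of_lt ht) (h.abs_partial_sum_le (h.abs_layerValue_le t) u le_rfl)
  have hDt : |D ^ t| < 2 ^ workBits S := h.abs_lt_bound ht.le (by
    rw [abs_of_pos (pow_pos h.denom_pos t)]
    exact h.denom_pow_le t)
  have hDt' : |D * D ^ t| < 2 ^ workBits S := h.abs_lt_bound (Nat.succ_le_of_lt ht) (by
    rw [← pow_succ', abs_of_pos (pow_pos h.denom_pos _)]
    exact h.denom_pow_le _)
  refine RamWp.cond (T := 35 * (workBits S + 1)) (h.allSmall_eqTest hs.input hs.var_four hu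
    (by norm_num) h.inp_nonneg h.inp_lt) (by simp only [RamExpr.size]; omega) (fun hc => ?_) fun hc => ?_
  · rw [eval_eqTest_pos] at hc
    simp only [RamExpr.eval, hs.var_four, hs.input] at hc
    refine RamWp.assign (k := workBits S) ?_ (by simp only [RamExpr.size]; omega)
      ⟨hs.setVar (by norm_num) _, ?_⟩
    · simp only [RamExpr.AllSmall, RamExpr.eval, hs.var_one, hs.var_two]
      exact ⟨h.abs_denom_lt, hDt, hDt'⟩
    · simp [RamExpr.eval, hs.var_one, hs.var_two, layerValue, hc]
  rw [eval_eqTest_pos] at hc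
  simp only [RamExpr.eval, hs.var_four, hs.input] at hc
  refine RamWp.cond (T := 20 * (workBits S + 1)) (h.allSmall_eqTest hs.input hs.var_four hu
    (by norm_num) h.out_nonneg h.out_lt) (by simp only [RamExpr.size]; omega) (fun hc' => ?_) fun hc' => ?_
  · rw [eval_eqTest_pos] at hc'
    simp only [RamExpr.eval, hs.var_four, hs.input] at hc'
    refine (RamWp.skip (T := 0) ⟨hs, ?_⟩).mono (by omega) fun _ h => h
    rw [layerValue, if_neg hc, if_pos hc', h6]
  rw [eval_eqTest_pos] at hc'
  simp only [RamExpr.eval, hs.var_four, hs.input] at hc'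
  refine RamWp.cond (k := workBits S) (T := 10 * (workBits S + 1)) h6' (by simp only [RamExpr.size]; omega)
    (fun hp => ?_) fun hp => ?_
  · refine (RamWp.skip (T := 0) ⟨hs, ?_⟩).mono (by omega) fun _ h => h
    simp only [RamExpr.eval] at hp
    rw [layerValue, if_neg hc, if_neg hc', ← h6, max_eq_right hp.le]
  · refine RamWp.assign (allSmall_lit S s (by norm_num)) (by simp only [RamExpr.size]; omega)
      ⟨hs.setVar (by norm_num) _, ?_⟩
    simp only [RamExpr.eval, not_lt] at hp
    rw [layerValue, if_neg hc, if_neg hc', ← h6, max_eq_left hp]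
    simp [RamExpr.eval]

theorem nodeProg_wp (h : NetArray a D n S) {t u : ℕ} (ht : t < n) (hu : u < n) {s : RamState}
    (hs : NodeState a D n t u s) :
    RamWp nodeProg s ((n + 1) * (300 * (workBits S + 1))) (NodeState a D n t (u + 1)) := by
  have hB : (n + 1) * (300 * (workBits S + 1)) =
      (n + 1) * (100 * (workBits S + 1)) + 200 * (workBits S + 1) + 200 * (n * (workBits S + 1)) := by
    ring
  refine RamWp.seq (T₁ := 20 * (workBits S + 1))
    (T₂ := (n + 1) * (100 * (workBits S + 1)) + 150 * (workBits S + 1))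
    (RamWp.assign (h.allSmall_bias ht hu hs) (by simp only [RamExpr.size]; omega) ?_) (by omega)
  refine RamWp.seq (T₁ := 10 * (workBits S + 1))
    (T₂ := (n + 1) * (100 * (workBits S + 1)) + 130 * (workBits S + 1))
    (RamWp.assign (allSmall_lit S _ (by norm_num)) (by simp only [RamExpr.size]; omega) ?_) (by omega)
  refine RamWp.seq (T₂ := 120 * (workBits S + 1)) ((h.sumProg_wp ht hu
    ((hs.setVar (by norm_num) _).setVar (by norm_num) _) ?_ ?_).mono le_rfl ?_) (by omega)
  · simp [RamExpr.eval]
  · simp [RamExpr.eval, hs.input, hs.var_one, hs.var_two, hs.var_four, scaledBias]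
  clear! s
  rintro s ⟨hs, h6⟩
  refine RamWp.seq (T₂ := 60 * (workBits S + 1))
    ((h.activationProg_wp ht hu hs h6).mono le_rfl ?_) (by omega)
  clear! s
  rintro s ⟨hs, h6⟩
  have htu := mul_add_lt ht hu
  have htn : (0 : ℤ) ≤ t * n := by positivity
  have hn : (0 : ℤ) ≤ n * n := by positivity
  have ht' : (t : ℤ) < n := by exact_mod_cast ht
  have hu' : (u : ℤ) < n := by exact_mod_cast hu
  have hu0 : (0 : ℤ) ≤ u := Int.natCast_nonneg u
  have ht0 : (0 : ℤ) ≤ t := Int.natCast_nonneg t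
  have hH := h.index_lt
  refine RamWp.seq (T₁ := 20 * (workBits S + 1)) (T₂ := 10 * (workBits S + 1))
    (RamWp.store (k := workBits S) ?_ ?_ (by simp only [RamExpr.size]; omega) ?_) (by omega)
  · simp only [RamExpr.AllSmall, RamExpr.eval, hs.input, hs.var_three, hs.var_four, h.size_eq]
    generalize (2 : ℤ) ^ workBits S = H at *
    repeat' apply And.intro
    all_goals refine abs_lt.2 ⟨?_, ?_⟩ <;> linarith only [htu, htn, hn, ht', hu', hu0, ht0, hH]
  · change |s.var 6| < _
    rw [h6]
    exact h.abs_lt_bound (Nat.succ_le_of_lt ht) (h.abs_layerValue_le _ _)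
  refine RamWp.assign (h.allSmall_succ (j := u) (by simpa using hs.var_four) hu.le)
    (by simp only [RamExpr.size]; omega) ?_
  simp only [RamExpr.eval, hs.input, hs.var_three, hs.var_four, h.size_eq, h6, RamState.setCell_var]
  constructor
  · rw [RamState.setVar_cell, RamState.setCell_cell_ne _ (by norm_num), hs.input]
  · simpa using hs.var_one
  · simpa using hs.var_two
  · simpa using hs.var_three
  · simp
  · intro v hv
    have hv' : (v : ℤ) < n := by exact_mod_cast hv
    rw [RamState.setVar_cell, RamState.setCell_cell_same, if_neg, hs.current v hv]
    intro he
    linarith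
  · intro v hv
    rw [RamState.setVar_cell, RamState.setCell_cell_same]
    by_cases hvu : v = u
    · rw [if_pos (by rw [hvu]), hvu]
    · rw [if_neg, hs.next v (by omega)]
      intro he
      have : (v : ℤ) = u := by linarith
      exact hvu (by exact_mod_cast this)

end NetArray

end Program

section Program

/-- The state before round `t + 1`. -/
structure RoundState (a : ℤ → ℤ) (D : ℤ) (n t : ℕ) (s : RamState) : Prop where
  input : s.cell 0 = a
  var_one : s.var 1 = D
  var_two : s.var 2 = D ^ t
  var_three : s.var 3 = t
  current : ∀ v : ℕ, v < n → s.cell 1 (t * n + v) = layerValue a D n t v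

namespace NetArray

variable {a : ℤ → ℤ} {D : ℤ} {n S : ℕ}

theorem abs_denom_pow_lt (h : NetArray a D n S) {t : ℕ} (ht : t ≤ n) :
    |D ^ t| < 2 ^ workBits S :=
  h.abs_lt_bound ht (by
    rw [abs_of_pos (pow_pos h.denom_pos t)]
    exact h.denom_pow_le t)

theorem roundProg_wp (h : NetArray a D n S) {t : ℕ} (ht : t < n) {s : RamState}
    (hs : RoundState a D n t s) :
    RamWp roundProg s ((n + 1) ^ 2 * (400 * (workBits S + 1))) (RoundState a D n (t + 1)) := by
  have hX : (n + 1) ^ 2 * (400 * (workBits S + 1)) =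
      (n + 1) * ((n + 1) * (320 * (workBits S + 1))) + 80 * (workBits S + 1) +
        160 * (n * (workBits S + 1)) + 80 * (n * n * (workBits S + 1)) := by ring
  refine RamWp.seq (T₁ := 10 * (workBits S + 1))
    (T₂ := (n + 1) * ((n + 1) * (320 * (workBits S + 1))) + 60 * (workBits S + 1))
    (RamWp.assign (allSmall_lit S _ (by norm_num)) (by simp only [RamExpr.size]; omega) ?_) (by omega)
  refine RamWp.seq (T₁ := (n + 1) * ((n + 1) * (320 * (workBits S + 1)))) (T₂ := 50 * (workBits S + 1))
    ((RamWp.loop (k := workBits S) (T := (n + 1) * (300 * (workBits S + 1)))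
    (fun u s => NodeState a D n t u s)
    (fun u s hu hs => h.allSmall_order_sub hs.input hs.var_four hu)
    (fun u s hu hs => h.eval_order_sub hs.input hs.var_four)
    (fun u s hu hs => h.nodeProg_wp ht hu hs) ?_).mono (Nat.mul_le_mul_left _ ?_) ?_) (by omega)
  · constructor
    · exact hs.input
    · simpa using hs.var_one
    · simpa using hs.var_two
    · simpa using hs.var_three
    · simp [RamExpr.eval]
    · exact hs.current
    · intro v hv
      omega
  · simp only [RamExpr.size]
    have : (n + 1) * (320 * (workBits S + 1)) = (n + 1) * (300 * (workBits S + 1)) +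
      20 * (workBits S + 1) + 20 * (n * (workBits S + 1)) := by ring
    omega
  clear! s
  intro s hs
  refine RamWp.seq (T₁ := 10 * (workBits S + 1)) (T₂ := 10 * (workBits S + 1))
    (RamWp.assign (k := workBits S) ?_ (by simp only [RamExpr.size]; omega) ?_) (by omega)
  · simp only [RamExpr.AllSmall, RamExpr.eval, hs.var_one, hs.var_two]
    exact ⟨h.abs_denom_pow_lt ht.le, h.abs_denom_lt, by
      rw [← pow_succ]
      exact h.abs_denom_pow_lt ht⟩
  refine RamWp.assign (h.allSmall_succ (j := t) (by simpa using hs.var_three) ht.le)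
    (by simp only [RamExpr.size]; omega) ?_
  constructor
  · exact hs.input
  · simpa using hs.var_one
  · simp [RamExpr.eval, hs.var_two, hs.var_one, pow_succ]
  · simp [RamExpr.eval, hs.var_three]
  · intro v hv
    have := hs.next v hv
    simpa using this

theorem parityProg_wp (h : NetArray a D n S) {s : RamState} {P : ℤ}
    (hP : |P| ≤ 2 ^ (3 * S * n)) (h2 : s.var 2 = D ^ n) (h6 : s.var 6 = P) :
    RamWp parityProg s (60 * (workBits S + 1)) fun s' =>
      (0 ≤ P ∧ 2 * D ^ n ∣ P → s'.var 0 = 1) ∧ (¬ (0 ≤ P ∧ 2 * D ^ n ∣ P) → s'.var 0 = 0) := by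
  have hD0 : 0 < D ^ n := pow_pos h.denom_pos n
  have hDle := h.denom_pow_le n
  have hbound := pow_mul_le_bound h.order_le
  have hone : (1 : ℤ) ≤ 2 ^ (3 * S * n) := one_le_pow₀ (by norm_num)
  have hq : |P / (2 * D ^ n)| ≤ |P| := Int.abs_ediv_le_abs _ _
  have hmod := Int.emod_nonneg P (show 2 * D ^ n ≠ 0 by positivity)
  have hmod' := Int.emod_lt_of_pos P (show 0 < 2 * D ^ n by positivity)
  have hdef := Int.emod_def P (2 * D ^ n)
  have hdvd : 2 * D ^ n ∣ P ↔ P % (2 * D ^ n) = 0 := Int.dvd_iff_emod_eq_zero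
  obtain ⟨hP1, hP2⟩ := abs_le.1 hP
  obtain ⟨hq1, hq2⟩ := abs_le.1 (hq.trans hP)
  have hset : ∀ (s : RamState) (z : ℤ) (hz : |z| ≤ 2) (Q : RamState → Prop), Q (s.setVar 0 z) →
      RamWp (.assign 0 (.lit z)) s (10 * (workBits S + 1)) Q := fun s z hz Q hQ =>
    RamWp.assign (allSmall_lit S s hz) (by simp only [RamExpr.size]; omega) hQ
  refine RamWp.cond (k := workBits S) (T := 40 * (workBits S + 1)) ?_
    (by simp only [RamExpr.size]; omega) (fun hc => ?_) fun hc => ?_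
  · simp only [RamExpr.AllSmall, RamExpr.eval, h6]
    refine ⟨?_, ?_, ?_⟩ <;> refine abs_lt.2 ⟨?_, ?_⟩ <;> linarith
  · simp only [RamExpr.eval, h6] at hc
    refine RamWp.cond (k := workBits S) (T := 10 * (workBits S + 1)) ?_
      (by simp only [RamExpr.size]; omega) (fun hc' => ?_) fun hc' => ?_
    · simp only [RamExpr.AllSmall, RamExpr.eval, h6, h2]
      generalize P / (2 * D ^ n) = q at *
      generalize P % (2 * D ^ n) = r at *
      generalize D ^ n = E at *
      generalize hw : 2 * E * q = w at *
      generalize (2 : ℤ) ^ workBits S = H at *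
      repeat' apply And.intro
      all_goals refine abs_lt.2 ⟨?_, ?_⟩ <;> linarith
    · simp only [RamExpr.eval, h6, h2, ← hdef] at hc'
      refine hset s 1 (by norm_num) _ ?_
      refine ⟨fun _ => by simp, fun hn => ?_⟩
      exact (hn ⟨by omega, hdvd.2 (by omega)⟩).elim
    · simp only [RamExpr.eval, h6, h2, ← hdef] at hc'
      refine hset s 0 (by norm_num) _ ?_
      refine ⟨fun hn => ?_, fun _ => by simp⟩
      have := hdvd.1 hn.2
      omega
  · simp only [RamExpr.eval, h6] at hc
    refine (hset s 0 (by norm_num) _ ?_).mono (by omega) fun _ h => h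
    exact ⟨fun hn => absurd hn.1 (by omega), fun _ => by simp⟩

end NetArray

/-- The product of the positive numbers among the first `k` entries. -/
def denomProduct (a : ℤ → ℤ) (k : ℕ) : ℤ := ∏ i ∈ Finset.range k, max 1 (a i)

theorem denomProduct_pos (a : ℤ → ℤ) (k : ℕ) : 0 < denomProduct a k :=
  Finset.prod_pos fun _ _ => lt_of_lt_of_le one_pos (le_max_left _ _)

/-- The state after the first `k` entries have been multiplied up. -/
structure DenomState (a : ℤ → ℤ) (L k : ℕ) (s : RamState) : Prop where
  input : s.cell 0 = a
  work : s.cell 1 = 0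
  var_zero : s.var 0 = L
  var_one : s.var 1 = denomProduct a k
  var_three : s.var 3 = 0
  var_seven : s.var 7 = k

theorem denomProg_wp {a : ℤ → ℤ} {L S : ℕ} (hL : L ≤ S) (ha : ∀ k, |a k| ≤ 2 ^ S)
    (hprod : ∀ k ≤ L, denomProduct a k ≤ 2 ^ S) {s : RamState} (hin : s.cell 0 = a)
    (hwork : s.cell 1 = 0) (h0 : s.var 0 = L) (h3 : s.var 3 = 0) (h7 : s.var 7 = 0) :
    RamWp denomProg s ((L + 2) * (60 * (workBits S + 1))) (DenomState a L L) := by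
  have hlt : (2 : ℤ) ^ S * 4 ≤ 2 ^ workBits S := by
    rw [show (4 : ℤ) = 2 ^ 2 by norm_num, ← pow_add]
    exact pow_le_pow_right₀ (by norm_num) (by unfold workBits; nlinarith [Nat.le_mul_self S])
  have hSlt : (S : ℤ) < 2 ^ S := by exact_mod_cast (Nat.lt_two_pow_self : S < 2 ^ S)
  have hL' : (L : ℤ) ≤ S := by exact_mod_cast hL
  have hL0 : (0 : ℤ) ≤ L := Int.natCast_nonneg L
  have hX : (L + 2) * (60 * (workBits S + 1)) =
    (L + 1) * (60 * (workBits S + 1)) + 60 * (workBits S + 1) := by ring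
  refine RamWp.seq (T₁ := 10 * (workBits S + 1)) (T₂ := (L + 1) * (60 * (workBits S + 1)))
    (RamWp.assign (NetArray.allSmall_lit S _ (by norm_num)) (by simp only [RamExpr.size]; omega) ?_)
    (by omega)
  refine (RamWp.loop (k := workBits S) (T := 50 * (workBits S + 1)) (N := L) (DenomState a L)
    (fun k s hk hs => ?_) (fun k s hk hs => ?_) (fun k s hk hs => ?_) ?_).mono
    (Nat.mul_le_mul_left _ (by simp only [RamExpr.size]; omega)) fun _ h => h
  · have hk' : (k : ℤ) ≤ L := by exact_mod_cast hk
    have hk0 : (0 : ℤ) ≤ k := Int.natCast_nonneg k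
    simp only [RamExpr.AllSmall, RamExpr.eval, hs.var_zero, hs.var_seven]
    refine ⟨?_, ?_, ?_⟩ <;> refine abs_lt.2 ⟨?_, ?_⟩ <;> linarith
  · simp only [RamExpr.eval, hs.var_zero, hs.var_seven]
  · have hk' : (k : ℤ) < L := by exact_mod_cast hk
    have hk0 : (0 : ℤ) ≤ k := Int.natCast_nonneg k
    have hksmall : |(k : ℤ)| < 2 ^ workBits S := abs_lt.2 ⟨by linarith, by linarith⟩
    have hk1small : |(k : ℤ) + 1| < 2 ^ workBits S := abs_lt.2 ⟨by linarith, by linarith⟩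
    have hasmall : |a k| < 2 ^ workBits S := (ha k).trans_lt (by linarith)
    have hdsmall : ∀ k ≤ L, |denomProduct a k| < 2 ^ workBits S := fun k hk => by
      rw [abs_of_pos (denomProduct_pos a k)]
      linarith [hprod k hk]
    have hsucc : denomProduct a (k + 1) = denomProduct a k * max 1 (a k) := by
      rw [denomProduct, Finset.prod_range_succ, denomProduct]
    refine RamWp.seq (T₁ := 30 * (workBits S + 1)) (T₂ := 10 * (workBits S + 1))
      (RamWp.cond (k := workBits S) (T := 10 * (workBits S + 1)) ?_
        (by simp only [RamExpr.size]; omega) (fun hc => ?_) fun hc => ?_) (by omega)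
    · simp only [RamExpr.AllSmall, RamExpr.eval, hs.var_seven, hs.input]
      exact ⟨hksmall, hasmall⟩
    all_goals simp only [RamExpr.eval, hs.var_seven, hs.input] at hc
    · refine RamWp.assign (k := workBits S) ?_ (by simp only [RamExpr.size]; omega)
        (RamWp.assign (k := workBits S) ?_ (by simp only [RamExpr.size]; omega) ?_)
      · simp only [RamExpr.AllSmall, RamExpr.eval, hs.var_seven, hs.input, hs.var_one]
        refine ⟨hdsmall k hk.le, ⟨hksmall, hasmall⟩, ?_⟩
        have := hdsmall (k + 1) hk
        rwa [hsucc, max_eq_right (by omega)] at this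
      · simp only [RamExpr.AllSmall, RamExpr.eval]
        simp only [RamState.setVar_var, hs.var_seven]
        exact ⟨hksmall, by
          rw [abs_one]
          linarith, hk1small⟩
      · constructor
        · exact hs.input
        · exact hs.work
        · simpa using hs.var_zero
        · simp [RamExpr.eval, hs.var_one, hs.var_seven, hs.input, hsucc, max_eq_right (show 1 ≤ a k by omega)]
        · simpa using hs.var_three
        · simp [RamExpr.eval, hs.var_seven]
    · refine (RamWp.skip (T := 0) (RamWp.assign (k := workBits S) ?_
        (by simp only [RamExpr.size]; omega) ?_)).mono (by omega) fun _ h => h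
      · simp only [RamExpr.AllSmall, RamExpr.eval, hs.var_seven]
        exact ⟨hksmall, by
          rw [abs_one]
          linarith, hk1small⟩
      · constructor
        · exact hs.input
        · exact hs.work
        · simpa using hs.var_zero
        · simp [hs.var_one, hsucc, max_eq_left (show a k ≤ 1 by omega)]
        · simpa using hs.var_three
        · simp [RamExpr.eval, hs.var_seven]
  · constructor
    · exact hin
    · exact hwork
    · simpa using h0
    · simp [RamExpr.eval, denomProduct]
    · simpa using h3
    · simpa using h7

theorem evenAtOneProg_wp {a : ℤ → ℤ} {n o L S : ℕ} (h : NetArray a (denomProduct a L) n S)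
    (ho : a 2 = o) (hL : L ≤ S) (hprod : ∀ k ≤ L, denomProduct a k ≤ 2 ^ S) {s : RamState}
    (hin : s.cell 0 = a) (hwork : s.cell 1 = 0) (h0 : s.var 0 = L) (h3 : s.var 3 = 0)
    (h7 : s.var 7 = 0) :
    RamWp evenAtOneProg s ((S + 2) ^ 3 * (700 * (workBits S + 1))) fun s' =>
      (0 ≤ layerValue a (denomProduct a L) n n o ∧
          2 * denomProduct a L ^ n ∣ layerValue a (denomProduct a L) n n o → s'.var 0 = 1) ∧
        (¬ (0 ≤ layerValue a (denomProduct a L) n n o ∧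
          2 * denomProduct a L ^ n ∣ layerValue a (denomProduct a L) n n o) → s'.var 0 = 0) := by
  have hn := h.order_le
  have ho' : o < n := by
    have := h.out_lt
    rw [ho] at this
    exact_mod_cast this
  have hX : (L + 2) * (60 * (workBits S + 1)) + (n + 1) ^ 3 * (420 * (workBits S + 1)) +
      100 * (workBits S + 1) + 5 ≤ (S + 2) ^ 3 * (700 * (workBits S + 1)) := by
    have h1 : (L + 2) ≤ (S + 2) ^ 3 :=
      (Nat.add_le_add_right hL 2).trans (Nat.le_self_pow (by norm_num) _)
    have h2 : (n + 1) ^ 3 ≤ (S + 2) ^ 3 := Nat.pow_le_pow_left (by omega) 3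
    have h3 : 1 ≤ (S + 2) ^ 3 := Nat.one_le_pow _ _ (by omega)
    generalize (S + 2) ^ 3 = X at *
    generalize (n + 1) ^ 3 = Y at *
    have hB : 1 ≤ workBits S + 1 := by omega
    generalize workBits S + 1 = B at *
    have h4 := Nat.mul_le_mul_right B h1
    have h5 := Nat.mul_le_mul_right B h2
    have h6 := Nat.mul_le_mul_right B h3
    have e1 : (L + 2) * (60 * B) = 60 * ((L + 2) * B) := by ring
    have e2 : Y * (420 * B) = 420 * (Y * B) := by ring
    have e3 : X * (700 * B) = 700 * (X * B) := by ring
    omega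
  refine RamWp.seq (T₂ := (n + 1) ^ 3 * (420 * (workBits S + 1)) + 100 * (workBits S + 1) + 4)
    ((denomProg_wp hL h.small hprod hin hwork h0 h3 h7).mono le_rfl ?_) (by omega)
  clear! s
  intro s hs
  refine RamWp.seq (T₁ := 10 * (workBits S + 1))
    (T₂ := (n + 1) ^ 3 * (420 * (workBits S + 1)) + 90 * (workBits S + 1) + 3)
    (RamWp.assign (NetArray.allSmall_lit S _ (by norm_num)) (by simp only [RamExpr.size]; omega) ?_)
    (by omega)
  refine RamWp.seq (T₁ := (n + 1) ^ 3 * (420 * (workBits S + 1))) (T₂ := 90 * (workBits S + 1) + 2)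
    ((RamWp.loop (k := workBits S) (T := (n + 1) ^ 2 * (400 * (workBits S + 1)))
    (RoundState a (denomProduct a L) n)
    (fun u s hu hs => h.allSmall_order_sub hs.input hs.var_three hu)
    (fun u s hu hs => h.eval_order_sub hs.input hs.var_three)
    (fun u s hu hs => h.roundProg_wp hu hs) ?_).mono ?_ ?_) (by omega)
  · constructor
    · exact hs.input
    · simpa using hs.var_one
    · simp [RamExpr.eval]
    · simpa using hs.var_three
    · intro v _
      simp [hs.work, layerValue]
  · have : (n + 1) ^ 3 * (420 * (workBits S + 1)) =
        (n + 1) * ((n + 1) ^ 2 * (420 * (workBits S + 1))) := by ring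
    rw [this]
    refine Nat.mul_le_mul_left _ ?_
    have h1 : 1 ≤ (n + 1) ^ 2 := Nat.one_le_pow _ _ (by omega)
    have h2 := Nat.mul_le_mul_right (20 * (workBits S + 1)) h1
    have h3 : (n + 1) ^ 2 * (420 * (workBits S + 1)) = (n + 1) ^ 2 * (400 * (workBits S + 1)) +
      (n + 1) ^ 2 * (20 * (workBits S + 1)) := by ring
    simp only [RamExpr.size]
    omega
  clear! s
  intro s hs
  have hP : s.cell 1 (n * n + o) = layerValue a (denomProduct a L) n n o := hs.current o ho'
  have hPle := h.abs_layerValue_le n o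
  refine RamWp.seq (T₁ := 20 * (workBits S + 1)) (T₂ := 60 * (workBits S + 1))
    (RamWp.assign (k := workBits S) ?_ (by simp only [RamExpr.size]; omega)
      (h.parityProg_wp hPle (by simpa using hs.var_two) ?_)) (by omega)
  · have h2 : |(2 : ℤ)| < 2 ^ workBits S := NetArray.allSmall_lit S s (by norm_num)
    have hn0 : |(0 : ℤ)| < 2 ^ workBits S := NetArray.allSmall_lit S s (by norm_num)
    have hnn : (0 : ℤ) ≤ n * n := by positivity
    have hn1 : (0 : ℤ) ≤ n := by positivity
    have ho0 : (0 : ℤ) ≤ o := by positivity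
    have ho1 : (o : ℤ) < n := by exact_mod_cast ho'
    have hH := h.index_lt
    have hPlt := h.abs_lt_bound le_rfl hPle
    simp only [RamExpr.AllSmall, RamExpr.eval, hs.input, h.size_eq, ho, hP]
    generalize (2 : ℤ) ^ workBits S = H at *
    repeat' apply And.intro
    all_goals first
      | with_reducible assumption
      | refine abs_lt.2 ⟨?_, ?_⟩ <;> linarith only [hnn, hn1, ho0, ho1, hH]
  · simp [RamExpr.eval, hs.input, h.size_eq, ho, hP]

end Program

section Encoding

theorem getElem?_flatMap_of_length_eq {α β : Type} {f : α → List β} {m r : ℕ}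
    (hf : ∀ x, (f x).length = m) (hr : r < m) (l : List α) (i : ℕ) (hi : i < l.length) :
    (l.flatMap f)[m * i + r]? = (f l[i])[r]? := by
  induction l generalizing i with
  | nil => simp at hi
  | cons x l ih =>
    rw [List.flatMap_cons]
    cases i with
    | zero =>
      rw [mul_zero, zero_add, List.getElem?_append_left (by rw [hf]; exact hr)]
      rfl
    | succ i =>
      rw [List.getElem?_append_right (by rw [hf]; nlinarith), hf,
        show m * (i + 1) + r - m = m * i + r by rw [mul_add, mul_one]; omega,
        ih i (by simpa using hi)]
      rfl

theorem length_flatMap_of_length_eq {α β : Type} {f : α → List β} {m : ℕ}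
    (hf : ∀ x, (f x).length = m) (l : List α) : (l.flatMap f).length = l.length * m := by
  simp [List.length_flatMap, hf]

theorem sum_bitLength_getD (l : List ℤ) :
    ∑ i ∈ Finset.range l.length, bitLength (l.getD i 0) = inputSize l := by
  induction l with
  | nil => rfl
  | cons x l ih =>
    rw [List.length_cons, Finset.sum_range_succ', inputSize, List.map_cons, List.sum_cons, add_comm]
    congr 1

theorem abs_le_two_pow_bitLength (z : ℤ) : |z| ≤ 2 ^ bitLength z := by
  rw [Int.abs_eq_natAbs]
  have : z.natAbs ≤ 2 ^ bitLength z :=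
    (Nat.lt_size_self _).le.trans (Nat.pow_le_pow_right (by norm_num) (Nat.le_succ _))
  exact_mod_cast this

theorem length_le_inputSize (l : List ℤ) : l.length ≤ inputSize l := by
  rw [← sum_bitLength_getD]
  calc l.length = ∑ i ∈ Finset.range l.length, 1 := by simp
    _ ≤ _ := Finset.sum_le_sum fun i _ => Nat.succ_le_succ (Nat.zero_le _)

/-- The array that holds the input at the start. -/
def inputArray (l : List ℤ) : ℤ → ℤ := (RamState.start l).cell 0

theorem inputArray_natCast (l : List ℤ) (k : ℕ) : inputArray l k = l.getD k 0 := by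
  simp [inputArray, RamState.start]

theorem inputArray_eq {l : List ℤ} {z : ℤ} (k : ℕ) (hz : z = k) {x : ℤ} (hk : l[k]? = some x) :
    inputArray l z = x := by
  rw [hz, inputArray_natCast, List.getD_eq_getElem?_getD, hk, Option.getD_some]

theorem abs_inputArray_le (l : List ℤ) (z : ℤ) : |inputArray l z| ≤ 2 ^ inputSize l := by
  have h0 : |(0 : ℤ)| ≤ 2 ^ inputSize l := by simp
  rcases lt_or_ge z 0 with hz | hz
  · have : inputArray l z = 0 := if_neg (by omega)
    rwa [this]
  · lift z to ℕ using hz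
    rw [inputArray_natCast]
    by_cases hl : z < l.length
    · refine (abs_le_two_pow_bitLength _).trans (pow_le_pow_right₀ (by norm_num) ?_)
      rw [← sum_bitLength_getD]
      exact Finset.single_le_sum (f := fun i => bitLength (l.getD i 0)) (fun _ _ => Nat.zero_le _)
        (Finset.mem_range.2 hl)
    · rwa [List.getD_eq_default _ _ (by omega)]

theorem denomProduct_inputArray_le (l : List ℤ) {k : ℕ} (hk : k ≤ l.length) :
    denomProduct (inputArray l) k ≤ 2 ^ inputSize l :=
  calc denomProduct (inputArray l) k
      ≤ ∏ i ∈ Finset.range k, 2 ^ bitLength (l.getD i 0) := by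
        refine Finset.prod_le_prod (fun i _ => zero_le_one.trans (le_max_left _ _)) fun i _ => ?_
        rw [inputArray_natCast]
        exact max_le (one_le_pow₀ (by norm_num)) ((le_abs_self _).trans (abs_le_two_pow_bitLength _))
    _ = 2 ^ ∑ i ∈ Finset.range k, bitLength (l.getD i 0) := Finset.prod_pow_eq_pow_sum _ _ _
    _ ≤ 2 ^ inputSize l := by
        refine pow_le_pow_right₀ (by norm_num) ?_
        rw [← sum_bitLength_getD]
        exact Finset.sum_le_sum_of_subset (Finset.range_subset_range.2 hk)

theorem dvd_denomProduct {a : ℤ → ℤ} {L k : ℕ} (hk : k < L) (ha : 0 < a k) :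
    a k ∣ denomProduct a L := by
  have := Finset.dvd_prod_of_mem (fun i : ℕ => max 1 (a i)) (Finset.mem_range.2 hk)
  rwa [max_eq_right (by omega)] at this

variable (N : FNN 1 1 ℚ) {n : ℕ} (e : Fin n ≃ N.V)

theorem FNN.length_encode : (N.encode e).length = 3 * (n * n) + 2 * n + 3 := by
  unfold encode
  rw [List.length_append, List.length_append, length_flatMap_of_length_eq (m := 2) (fun _ => rfl),
    length_flatMap_of_length_eq (m := n * 3) (fun _ => by
      rw [length_flatMap_of_length_eq (m := 3) (fun _ => rfl), List.length_finRange])]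
  simp only [List.length_finRange, List.length_cons, List.length_nil]
  ring

theorem FNN.encode_bias (u : Fin n) {r : ℕ} (hr : r < 2) :
    (N.encode e)[3 + (2 * (u : ℕ) + r)]? =
      [(N.bias (e u)).num, ((N.bias (e u)).den : ℤ)][r]? := by
  have hlen := length_flatMap_of_length_eq (f := fun i => [(N.bias (e i)).num, ((N.bias (e i)).den : ℤ)])
    (m := 2) (fun _ => rfl) (List.finRange n)
  rw [List.length_finRange] at hlen
  unfold encode
  rw [List.getElem?_append_left, List.getElem?_append_right (by simp)]
  · have := getElem?_flatMap_of_length_eq (f := fun i => [(N.bias (e i)).num, ((N.bias (e i)).den : ℤ)])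
      (m := 2) (fun _ => rfl) hr (List.finRange n) u (by simp)
    simp only [List.getElem_finRange] at this
    simpa using this
  · rw [List.length_append, hlen]
    simp only [List.length_cons, List.length_nil]
    have := u.2
    omega

open Classical in
theorem FNN.encode_weight (v u : Fin n) {r : ℕ} (hr : r < 3) :
    (N.encode e)[3 + 2 * n + (3 * ((v : ℕ) * n + u) + r)]? =
      [if N.E (e v) (e u) then 1 else 0,
      (N.weight (e v) (e u)).num, ((N.weight (e v) (e u)).den : ℤ)][r]? := by
  have hlen := length_flatMap_of_length_eq (f := fun i => [(N.bias (e i)).num, ((N.bias (e i)).den : ℤ)])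
    (m := 2) (fun _ => rfl) (List.finRange n)
  rw [List.length_finRange] at hlen
  unfold encode
  rw [List.getElem?_append_right]
  · rw [List.length_append, hlen]
    simp only [List.length_cons, List.length_nil]
    rw [show 3 + 2 * n + (3 * ((v : ℕ) * n + u) + r) - (0 + 1 + 1 + 1 + n * 2) =
      (n * 3) * v + (3 * u + r) by
        have : n * 3 * (v : ℕ) = 3 * (v * n) := by ring
        omega]
    rw [getElem?_flatMap_of_length_eq (m := n * 3) (fun _ => by
      rw [length_flatMap_of_length_eq (m := 3) (fun _ => rfl), List.length_finRange])
      (by have := u.2; omega) (List.finRange n) v (by simp),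
      getElem?_flatMap_of_length_eq (m := 3) (fun _ => rfl) hr (List.finRange n) u (by simp)]
    simp
  · rw [List.length_append, hlen]
    simp only [List.length_cons, List.length_nil]
    omega

theorem FNN.inputArray_encode_one :
    inputArray (N.encode e) 1 = ((e.symm (N.inp 0) : ℕ) : ℤ) :=
  inputArray_eq 1 rfl rfl

theorem FNN.inputArray_encode_two :
    inputArray (N.encode e) 2 = ((e.symm (N.out 0) : ℕ) : ℤ) :=
  inputArray_eq 2 rfl rfl

theorem FNN.netArray_encode : NetArray (inputArray (N.encode e))
    (denomProduct (inputArray (N.encode e)) (N.encode e).length) n (inputSize (N.encode e)) where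
  size_eq := inputArray_eq 0 rfl rfl
  inp_nonneg := by
    rw [N.inputArray_encode_one]
    positivity
  inp_lt := by
    rw [N.inputArray_encode_one]
    exact_mod_cast Fin.is_lt _
  out_nonneg := by
    rw [N.inputArray_encode_two]
    positivity
  out_lt := by
    rw [N.inputArray_encode_two]
    exact_mod_cast Fin.is_lt _
  small := abs_inputArray_le _
  denom_pos := denomProduct_pos _ _
  denom_le := denomProduct_inputArray_le _ le_rfl
  size_le := by
    rw [← N.length_encode e]
    exact length_le_inputSize _

theorem cast_num_mul_div_den {q : ℚ} {D : ℤ} (h : (q.den : ℤ) ∣ D) :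
    ((q.num * (D / q.den) : ℤ) : ℝ) = D * (q : ℝ) := by
  obtain ⟨c, rfl⟩ := h
  have hd : (q.den : ℤ) ≠ 0 := by exact_mod_cast q.den_nz
  have hd' : (q.den : ℝ) ≠ 0 := by exact_mod_cast q.den_nz
  rw [Int.mul_ediv_cancel_left _ hd, Rat.cast_def]
  push_cast
  field_simp

theorem FNN.scaledBias_encode (u : Fin n) :
    (scaledBias (inputArray (N.encode e)) (denomProduct (inputArray (N.encode e)) (N.encode e).length)
      u : ℝ) = denomProduct (inputArray (N.encode e)) (N.encode e).length * (N.bias (e u) : ℝ) := by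
  have hnum : inputArray (N.encode e) (3 + 2 * (u : ℕ)) = (N.bias (e u)).num :=
    inputArray_eq (3 + (2 * u + 0)) (by push_cast; ring) (N.encode_bias e u (by norm_num))
  have hden : inputArray (N.encode e) (3 + (2 * u + 1) : ℕ) = (N.bias (e u)).den :=
    inputArray_eq (3 + (2 * u + 1)) rfl (N.encode_bias e u (by norm_num))
  have hden' : inputArray (N.encode e) (4 + 2 * (u : ℕ)) = (N.bias (e u)).den := by
    rw [← hden]
    congr 1
    push_cast
    ring
  unfold scaledBias
  rw [hnum, hden']
  refine cast_num_mul_div_den ?_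
  rw [← hden]
  refine dvd_denomProduct ?_ ?_
  · rw [N.length_encode e]
    have := u.2
    nlinarith
  · rw [hden]
    exact_mod_cast Rat.den_pos _

theorem FNN.scaledWeight_encode (v u : Fin n) :
    (scaledWeight (inputArray (N.encode e))
      (denomProduct (inputArray (N.encode e)) (N.encode e).length) n v u : ℝ) =
      denomProduct (inputArray (N.encode e)) (N.encode e).length * (N.weight (e v) (e u) : ℝ) := by
  have hnum : inputArray (N.encode e) (3 + 2 * n + 3 * ((v : ℕ) * n + (u : ℕ)) + 1) =
      (N.weight (e v) (e u)).num :=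
    inputArray_eq (3 + 2 * n + (3 * (v * n + u) + 1)) (by push_cast; ring)
      (N.encode_weight e v u (by norm_num))
  have hden : inputArray (N.encode e) (3 + 2 * n + (3 * (v * n + u) + 2) : ℕ) =
      (N.weight (e v) (e u)).den :=
    inputArray_eq (3 + 2 * n + (3 * (v * n + u) + 2)) rfl (N.encode_weight e v u (by norm_num))
  have hden' : inputArray (N.encode e) (3 + 2 * n + 3 * ((v : ℕ) * n + (u : ℕ)) + 2) =
      (N.weight (e v) (e u)).den := by
    rw [← hden]
    congr 1
  unfold scaledWeight
  rw [hnum, hden']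
  refine cast_num_mul_div_den ?_
  rw [← hden]
  refine dvd_denomProduct ?_ ?_
  · rw [N.length_encode e]
    have := u.2
    have := v.2
    have : (v : ℕ) * n + u < n * n := by nlinarith
    omega
  · rw [hden]
    exact_mod_cast Rat.den_pos _

end Encoding

section Evaluation

/-- The number of nodes from which `u` can be reached. -/
noncomputable def FNN.rank {m p : ℕ} {R : Type} [Zero R] (N : FNN m p R) (u : N.V) : ℕ :=
  {v | Relation.TransGen N.E v u}.ncard

theorem FNN.rank_lt_rank {m p : ℕ} {R : Type} [Zero R] (N : FNN m p R) {v u : N.V} (h : N.E v u) :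
    N.rank v < N.rank u := by
  refine Set.ncard_lt_ncard ⟨fun w hw => hw.tail h, fun hsub => ?_⟩ (Set.toFinite _)
  exact N.acyclic v (hsub (Relation.TransGen.single h))

theorem FNN.rank_lt_card {m p : ℕ} {R : Type} [Zero R] (N : FNN m p R) (u : N.V) :
    N.rank u < Nat.card N.V := by
  rw [← Set.ncard_univ]
  exact Set.ncard_lt_ncard ⟨Set.subset_univ _, fun hsub => N.acyclic u (hsub (Set.mem_univ u))⟩
    (Set.toFinite _)

variable (N : FNN 1 1 ℚ) {n : ℕ} (e : Fin n ≃ N.V)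

theorem FNN.layerValue_encode {D : ℤ}
    (hD : D = denomProduct (inputArray (N.encode e)) (N.encode e).length) (t : ℕ) (u : Fin n)
    (hu : N.rank (e u) < t) : (layerValue (inputArray (N.encode e)) D n t u : ℝ) =
      D ^ t * N.toReal.nodeValue (fun _ => 1) (e u) := by
  induction t generalizing u with
  | zero => omega
  | succ t ih =>
    have hsum : ((scaledBias (inputArray (N.encode e)) D u * D ^ t + ∑ v ∈ Finset.range n,
        scaledWeight (inputArray (N.encode e)) D n v u *
          layerValue (inputArray (N.encode e)) D n t v : ℤ) : ℝ) =
        D ^ (t + 1) * N.toReal.preactivation (fun _ => 1) (e u) := by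
      have hpre : N.toReal.preactivation (fun _ => 1) (e u) = (N.bias (e u) : ℝ) +
          ∑ v : Fin n, (N.weight (e v) (e u) : ℝ) * N.toReal.nodeValue (fun _ => 1) (e v) :=
        congrArg _ (e.sum_comp fun v =>
          N.toReal.weight v (e u) * N.toReal.nodeValue (fun _ => 1) v).symm
      rw [hpre]
      push_cast
      rw [Finset.sum_range, mul_add, Finset.mul_sum]
      subst hD
      rw [N.scaledBias_encode e u]
      congr 1
      · ring
      · refine Finset.sum_congr rfl fun v _ => ?_
        rw [N.scaledWeight_encode e v u]
        by_cases hE : N.E (e v) (e u)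
        · rw [ih v (by have := N.rank_lt_rank hE; omega)]
          ring
        · rw [N.weight_of_not_edge _ _ hE]
          simp
    have hind : ∀ x, ((u : ℕ) : ℤ) = ((e.symm x : ℕ) : ℤ) ↔ x = e u := fun x => by
      rw [Nat.cast_inj, Fin.val_inj, Equiv.eq_symm_apply, eq_comm]
    have hDpos : (0 : ℝ) < D ^ (t + 1) := by
      have : 0 < D := hD ▸ denomProduct_pos _ _
      positivity
    rw [layerValue, N.inputArray_encode_one, N.inputArray_encode_two]
    split_ifs with h1 h2
    · rw [hind] at h1
      have : N.toReal.nodeValue (fun _ => 1) (e u) = 1 := by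
        rw [← h1]
        exact N.toReal.nodeValue_inp _ 0
      rw [this]
      push_cast
      ring
    · rw [hind] at h2
      rw [hsum, ← h2]
      congr 1
      exact (N.toReal.nodeValue_out _ 0).symm
    · rw [hind] at h1 h2
      have := N.toReal.nodeValue_hidden (fun _ => 1) (u := e u)
        (fun ⟨i, hi⟩ => h1 (by rw [← hi, Subsingleton.elim i 0]; rfl))
        (fun ⟨i, hi⟩ => h2 (by rw [← hi, Subsingleton.elim i 0]; rfl))
      rw [this, Int.cast_max, hsum, Int.cast_zero, mul_max_of_nonneg _ _ hDpos.le, mul_zero]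

theorem FNN.evenAtOne_toReal_iff {D : ℤ}
    (hD : D = denomProduct (inputArray (N.encode e)) (N.encode e).length) :
    evenAtOne N.toReal ↔ 0 ≤ layerValue (inputArray (N.encode e)) D n n (e.symm (N.out 0)) ∧
      2 * D ^ n ∣ layerValue (inputArray (N.encode e)) D n n (e.symm (N.out 0)) := by
  have hn : Nat.card N.V = n := by rw [← Nat.card_congr e, Nat.card_fin]
  have hval := N.layerValue_encode e hD n (e.symm (N.out 0)) ((N.rank_lt_card _).trans_eq hn)
  rw [Equiv.apply_symm_apply] at hval
  have hDpos : 0 < D ^ n := pow_pos (hD ▸ denomProduct_pos _ _) n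
  have hDpos' : (0 : ℝ) < D ^ n := by exact_mod_cast hDpos
  generalize layerValue (inputArray (N.encode e)) D n n (e.symm (N.out 0)) = P at *
  change (∃ k : ℕ, Even k ∧ N.toReal.nodeValue (fun _ => 1) (N.out 0) = k) ↔ _
  constructor
  · rintro ⟨k, ⟨j, rfl⟩, hk⟩
    rw [hk] at hval
    have : P = D ^ n * ((j + j : ℕ) : ℤ) := by exact_mod_cast hval
    rw [this]
    exact ⟨by positivity, j, by push_cast; ring⟩
  · rintro ⟨h0, j, hj⟩
    have hj0 : 0 ≤ j := by
      by_contra hneg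
      have : 2 * D ^ n * j < 0 := mul_neg_of_pos_of_neg (by linarith) (by linarith)
      omega
    lift j to ℕ using hj0
    refine ⟨2 * j, even_two_mul j, mul_left_cancel₀ hDpos'.ne' ?_⟩
    rw [← hval, hj]
    push_cast
    ring

theorem polyTimeDecidable_evenAtOne : evenAtOne.PolyTimeDecidable := by
  refine ⟨evenAtOneProg, (Polynomial.X + 2) ^ 3 * (700 * (3 * Polynomial.X * Polynomial.X + 10 + 1)),
    fun N n e => ?_⟩
  obtain ⟨t, s, hrun, ht, h1, h0⟩ := evenAtOneProg_wp (N.netArray_encode e)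
    (o := e.symm (N.out 0)) (N.inputArray_encode_two e) (length_le_inputSize _)
    (fun k hk => denomProduct_inputArray_le _ hk) (s := RamState.start (N.encode e)) rfl
    (by funext z; simp [RamState.start]) (by simp [RamState.start]) (by simp [RamState.start])
    (by simp [RamState.start])
  rw [← N.evenAtOne_toReal_iff e rfl] at h1 h0
  refine ⟨t, s, hrun, ht.trans (le_of_eq ?_), h1, h0⟩
  simp [workBits]

theorem modelAgnostic_evenAtOne : evenAtOne.ModelAgnostic := by
  intro N N' h
  unfold evenAtOne
  rw [h]

end Evaluation

theorem mainTheorem7 :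
    evenAtOne.ModelAgnostic ∧ evenAtOne.PolyTimeDecidable ∧
      ¬ evenAtOne.ExpressibleOn FNN.ZeroOneWeights :=
  ⟨modelAgnostic_evenAtOne, polyTimeDecidable_evenAtOne, not_expressibleOn_evenAtOne⟩
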